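/- Let $\mathbb{D}=\{\zeta\in\mathbb{C}:|\zeta|<1\}$ and $\mathbb{T}=\{\zeta\in\mathbb{C}:|\zeta|=1\}$, and let $b\mathbb{D}^2$ be the topological boundary of the bidisc $\mathbb{D}^2$ in $\mathbb{C}^2$. Let $A^2(\mathbb{D}^2)$ be the Bergman space, that is, the space of all holomorphic functions $f:\mathbb{D}^2\to\mathbb{C}$ with $\|f\|^2=\int_{\mathbb{D}^2}|f|^2\,dV<\infty$, where $V$ is Lebesgue measure on $\mathbb{C}^2$. Theorem. Let $\varphi=(\varphi_1,\varphi_2):\mathbb{D}^2\to\mathbb{D}^2$ be a holomorphic self-map of the bidisc such that both $\varphi_1$ and $\varphi_2$ extend to Lipschitz functions on $\overline{\mathbb{D}^2}$ (the extension of $\varphi$ to $\overline{\mathbb{D}^2}$ is again denoted by $\varphi$). Then the composition operator $C_\varphi f=f\circ\varphi$ is compact on $A^2(\mathbb{D}^2)$ (that is, $f\circ\varphi\in A^2(\mathbb{D}^2)$ for every $f\in A^2(\mathbb{D}^2)$, and $C_\varphi:A^2(\mathbb{D}^2)\to A^2(\mathbb{D}^2)$ is a compact linear operator) if and only if $$\varphi(\overline{\mathbb{D}^2})\cap\mathbb{T}^2=\emptyset\quad\text{and}\quad\varphi(\overline{\mathbb{D}^2}\setminus\mathbb{T}^2)\cap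 b\mathbb{D}^2=\emptyset .$$ -/

import Mathlib

open Set MeasureTheory

noncomputable section

/-- The open unit bidisc `𝔻²` in `ℂ²`. -/
def bidisc : Set (ℂ × ℂ) := Metric.ball (0 : ℂ) 1 ×ˢ Metric.ball (0 : ℂ) 1

/-- The distinguished boundary `𝕋²`, the product of two unit circles. -/
def torus2 : Set (ℂ × ℂ) := Metric.sphere (0 : ℂ) 1 ×ˢ Metric.sphere (0 : ℂ) 1

theorem isOpen_bidisc : IsOpen bidisc := Metric.isOpen_ball.prod Metric.isOpen_ball

/-- The volume measure `dV` of `ℂ²` (Lebesgue measure), on the bidisc. -/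
def bidiscVolume : Measure bidisc := Measure.comap Subtype.val (volume : Measure (ℂ × ℂ))

/-- A function on the bidisc is holomorphic: it is the restriction of a function on `ℂ²` which is
complex differentiable at every point of the bidisc. -/
def IsHolomorphic (f : bidisc → ℂ) : Prop :=
  ∃ F : ℂ × ℂ → ℂ, DifferentiableOn ℂ F bidisc ∧ ∀ z : bidisc, f z = F z

theorem IsHolomorphic.continuous {f : bidisc → ℂ} (hf : IsHolomorphic f) : Continuous f := by
  obtain ⟨F, hF, h⟩ := hf
  have h2 := continuousOn_iff_continuous_domRestrict.1 hF.continuousOn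
  have h3 : f = bidisc.domRestrict F := funext h
  rw [h3]; exact h2

theorem memLp_two_iff {f : bidisc → ℂ} (hf : IsHolomorphic f) :
    MemLp f 2 bidiscVolume ↔ Integrable (fun z => ‖f z‖ ^ 2) bidiscVolume :=
  memLp_two_iff_integrable_sq_norm hf.continuous.aestronglyMeasurable

/-- The underlying vector space of `A²(𝔻²)`: the holomorphic functions on the bidisc whose squared
modulus is integrable with respect to the volume measure. -/
def bergmanSubmodule : Submodule ℂ (bidisc → ℂ) where
  carrier := {f | IsHolomorphic f ∧ Integrable (fun z => ‖f z‖ ^ 2) bidiscVolume}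
  zero_mem' := by
    refine ⟨⟨fun _ => 0, differentiableOn_const _, fun _ => rfl⟩, ?_⟩
    simp
  add_mem' := by
    rintro f g ⟨hf, hf2⟩ ⟨hg, hg2⟩
    have h : IsHolomorphic (f + g) := by
      obtain ⟨F, hF, hfF⟩ := hf
      obtain ⟨G, hG, hgG⟩ := hg
      exact ⟨F + G, hF.add hG, fun z => by simp [hfF, hgG]⟩
    exact ⟨h, (memLp_two_iff h).1 (((memLp_two_iff hf).2 hf2).add ((memLp_two_iff hg).2 hg2))⟩
  smul_mem' := by
    rintro c f ⟨hf, hf2⟩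
    have h : IsHolomorphic (c • f) := by
      obtain ⟨F, hF, hfF⟩ := hf
      exact ⟨c • F, hF.const_smul c, fun z => by simp [hfF]⟩
    exact ⟨h, (memLp_two_iff h).1 (((memLp_two_iff hf).2 hf2).const_smul c)⟩

/-- The Bergman space `A²(𝔻²)`. It is a type of its own, so that it carries the topology of the
`L²` norm (defined below) and not the topology of pointwise convergence. -/
def BergmanSpace : Type := bergmanSubmodule

namespace BergmanSpace

instance : AddCommGroup BergmanSpace := inferInstanceAs (AddCommGroup bergmanSubmodule)

instance : Module ℂ BergmanSpace := inferInstanceAs (Module ℂ bergmanSubmodule)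

/-- The function on the bidisc underlying an element of `A²(𝔻²)`. -/
def toFun (f : BergmanSpace) : bidisc → ℂ := (show bergmanSubmodule from f).1

/-- The element of `A²(𝔻²)` given by a square integrable holomorphic function. -/
def ofFun (f : bidisc → ℂ) (hf : f ∈ bergmanSubmodule) : BergmanSpace :=
  show bergmanSubmodule from ⟨f, hf⟩

instance : CoeFun BergmanSpace (fun _ => bidisc → ℂ) := ⟨toFun⟩

theorem toFun_mem (f : BergmanSpace) : toFun f ∈ bergmanSubmodule :=
  (show bergmanSubmodule from f).2

theorem toFun_injective : Function.Injective toFun := fun _ _ h => Subtype.ext h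

theorem memLp (f : BergmanSpace) : MemLp (toFun f) 2 bidiscVolume :=
  (memLp_two_iff (toFun_mem f).1).2 (toFun_mem f).2

/-- The inclusion of `A²(𝔻²)` into `L²(𝔻²)`. -/
def toL2 : BergmanSpace →ₗ[ℂ] Lp ℂ 2 bidiscVolume where
  toFun f := (memLp f).toLp (toFun f)
  map_add' _ _ := rfl
  map_smul' _ _ := rfl

theorem toL2_injective : Function.Injective toL2 := by
  intro f g h
  have hae := (MemLp.toLp_eq_toLp_iff (memLp f) (memLp g)).1 h
  have hpos : (bidiscVolume).IsOpenPosMeasure := by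
    refine ⟨fun U hU hne h0 => ?_⟩
    have himg : IsOpen (Subtype.val '' U) := isOpen_bidisc.isOpenMap_subtype_val U hU
    have h1 : bidiscVolume U = volume (Subtype.val '' U) :=
      comap_subtype_coe_apply isOpen_bidisc.measurableSet volume U
    rw [h1] at h0
    exact himg.measure_ne_zero volume (hne.image _) h0
  exact toFun_injective (Continuous.ae_eq_iff_eq bidiscVolume (toFun_mem f).1.continuous
    (toFun_mem g).1.continuous |>.1 hae)

/-- The norm of `A²(𝔻²)` is that of `L²(𝔻²)`. -/
instance : NormedAddCommGroup BergmanSpace :=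
  NormedAddCommGroup.induced BergmanSpace (Lp ℂ 2 bidiscVolume) toL2 toL2_injective

/-- The inner product of `A²(𝔻²)` is that of `L²(𝔻²)`. -/
instance : InnerProductSpace ℂ BergmanSpace where
  inner f g := inner ℂ (toL2 f) (toL2 g)
  norm_smul_le c f := by
    change ‖toL2 (c • f)‖ ≤ ‖c‖ * ‖toL2 f‖
    rw [map_smul, norm_smul]
  norm_sq_eq_re_inner f := norm_sq_eq_re_inner (𝕜 := ℂ) (toL2 f)
  conj_inner_symm f g := inner_conj_symm (toL2 f) (toL2 g)
  add_left f g h := by rw [map_add, inner_add_left]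
  smul_left f g c := by rw [map_smul, inner_smul_left]

theorem norm_sq_eq (f : BergmanSpace) : ‖f‖ ^ 2 = ∫ z, ‖f z‖ ^ 2 ∂bidiscVolume := by
  have h1 : (‖f‖ ^ 2 : ℝ) = RCLike.re (inner ℂ (toL2 f) (toL2 f)) :=
    norm_sq_eq_re_inner (𝕜 := ℂ) (toL2 f)
  have h2 : ∀ᵐ z ∂bidiscVolume, inner ℂ (toL2 f z) (toL2 f z) = ((‖f z‖ ^ 2 : ℝ) : ℂ) := by
    filter_upwards [(memLp f).coeFn_toLp] with z hz
    have hz' : toL2 f z = f z := hz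
    rw [hz', inner_self_eq_norm_sq_to_K]
    norm_cast
  rw [h1, L2.inner_def, integral_congr_ae h2]
  exact congrArg Complex.re (integral_ofReal (𝕜 := ℂ) (f := fun z => ‖f z‖ ^ 2))

end BergmanSpace

/-- `C_φ f = f ∘ φ` for a self-map `φ` of the bidisc and a function `f` on the bidisc. -/
def compSymbol (φ : bidisc → bidisc) (f : bidisc → ℂ) : bidisc → ℂ := fun z => f (φ z)

/-- The composition operator `C_φ`, as a linear operator on `A²(𝔻²)`, for a symbol `φ` such that
`C_φ` maps `A²(𝔻²)` into itself. -/
def compositionOperator (φ : bidisc → bidisc)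
    (h : ∀ f ∈ bergmanSubmodule, compSymbol φ f ∈ bergmanSubmodule) :
    BergmanSpace →ₗ[ℂ] BergmanSpace where
  toFun f := BergmanSpace.ofFun (compSymbol φ f) (h f f.toFun_mem)
  map_add' _ _ := rfl
  map_smul' _ _ := rfl

/-- `C_φ` is compact on `A²(𝔻²)`: it maps `A²(𝔻²)` into itself, and it is a compact operator for
the `L²` norm. -/
def IsCompactOnBergman (φ : bidisc → bidisc) : Prop :=
  ∃ h : ∀ f ∈ bergmanSubmodule, compSymbol φ f ∈ bergmanSubmodule,
    IsCompactOperator (compositionOperator φ h)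

end

/-!
The bidisc is the unit ball of `ℂ × ℂ` for the sup norm, so `1 - ‖u‖` is the distance of `u` to the
boundary.

*Sufficiency.* If `φ` reaches the boundary only from the torus, then, by compactness of the two
coordinate discs `𝔻 × {0}` and `{0} × 𝔻`, each coordinate `g` of `φ` has modulus at most `1 - c` on
them. Let `u` be a point of the disc and `δ = 1 - |u|`. By the Schwarz lemma on slices, `|g z - u| < δ`
forces both coordinates of `z` to be within `O(δ)` of the unit circle
(`one_sub_norm_ge_of_mapsTo_ball`). On each slice the positive harmonic function
`Re ((1 + conj u * g) / (1 - conj u * g))` has bounded mean over circles and is at least `1 / (9 δ)`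
where `|g - u| < δ`, which gives a further factor `δ` (`volume_diskCollar_inter_le`). Hence
`|g z - u| < δ` holds on a set of volume `O(δ ^ 3)` (`volume_near_point_le`), whereas a Carleson
measure condition asks only for `O(δ ^ 2)`. As `φ` avoids the torus, only one coordinate can approach
the circle at a time, and the sub-mean value property with Tonelli's theorem yields
`∫ |f ∘ φ| ^ 2 ≤ A ∫ (1 - ‖u‖) |f u| ^ 2` (`exists_lintegral_comp_le`). Since the weight vanishes at the
boundary, Montel's theorem and Fatou's lemma show that the image of the unit ball is sequentially
compact (`isCompactOnBergman_of_lintegral_comp_le`).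

*Necessity.* The functions `δ / (1 - (1 - δ) conj η u) ^ 2`, with `|η| = 1` and `δ → 0`, are bounded in
`L²` of the disc, tend to zero pointwise, and are of size `1 / δ` within `O(δ)` of `η`. If `φ p` lies on
the torus, the Lipschitz condition makes the product of two of them of size `δ ^ (-2)` after
composition, on a set of volume comparable to `δ ^ 4`. If `p` is not on the torus and a coordinate of
`φ` has modulus `1` at `p`, the maximum principle makes that coordinate constant on a disc through `p`,
and by the Lipschitz condition it stays within `O(δ)` of that constant on a set of volume comparable
to `δ ^ 2` (`exists_set_near_value`); there one such function of that coordinate is of size `1 / δ`. In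
both cases the norms of the compositions stay bounded below, which a compact operator does not allow
(`not_isCompactOnBergman_of_le_bergmanEnergy`).
-/

noncomputable section BergmanComposition

open Metric Filter
open scoped ENNReal NNReal Real ComplexConjugate Topology

/-! ### Mean values and growth in one variable -/

theorem setLIntegral_norm_mem_eq_polar {H : ℂ → ℝ≥0∞} (hH : Measurable H) {s : Set ℝ}
    (hs : MeasurableSet s) :
    ∫⁻ z in {z : ℂ | ‖z‖ ∈ s}, H z =
      ∫⁻ r in Ioi (0 : ℝ), s.indicator 1 r * (ENNReal.ofReal r *
        ∫⁻ θ in Ioo (-π) π, H (circleMap 0 r θ)) := by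
  have hS : MeasurableSet {z : ℂ | ‖z‖ ∈ s} := measurable_norm hs
  have hc : Measurable fun p : ℝ × ℝ => circleMap 0 p.1 p.2 := by
    unfold circleMap; fun_prop
  rw [← lintegral_indicator hS, ← Complex.lintegral_comp_polarCoord_symm,
    polarCoord_target]
  have h1 : ∀ p ∈ Ioi (0 : ℝ) ×ˢ Ioo (-π) π,
      ENNReal.ofReal p.1 • ({z : ℂ | ‖z‖ ∈ s}.indicator H (Complex.polarCoord.symm p)) =
      s.indicator 1 p.1 * (ENNReal.ofReal p.1 * H (circleMap 0 p.1 p.2)) := by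
    rintro ⟨r, θ⟩ ⟨hr, -⟩
    have hr' : (0 : ℝ) < r := hr
    have h2 : Complex.polarCoord.symm (r, θ) = circleMap 0 r θ := by
      rw [Complex.polarCoord_symm_apply, circleMap, zero_add, Complex.exp_mul_I,
        Complex.ofReal_cos, Complex.ofReal_sin]
    have h3 : ‖circleMap 0 r θ‖ = r := by simp [abs_of_pos hr']
    rw [h2]
    by_cases hrs : r ∈ s
    · rw [indicator_of_mem (by rw [mem_ofPred_eq, h3]; exact hrs), indicator_of_mem hrs]
      simp
    · rw [indicator_of_notMem (by rw [mem_ofPred_eq, h3]; exact hrs), indicator_of_notMem hrs]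
      simp
  rw [setLIntegral_congr_fun (measurableSet_Ioi.prod measurableSet_Ioo) h1,
    Measure.volume_eq_prod, setLIntegral_prod]
  · refine lintegral_congr fun r => ?_
    have hm : Measurable fun θ => H (circleMap 0 r θ) :=
      hH.comp (hc.comp measurable_prodMk_left)
    simp only
    rw [lintegral_const_mul _ (hm.const_mul _), lintegral_const_mul _ hm]
  · have : Measurable (s.indicator (1 : ℝ → ℝ≥0∞)) := measurable_one.indicator hs
    exact ((this.comp measurable_fst).mul
      ((ENNReal.measurable_ofReal.comp measurable_fst).mul (hH.comp hc))).aemeasurable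

/-- A comparison of the means over circles gives a comparison of the integrals over a radial set. -/
theorem setLIntegral_norm_mem_mono {H G : ℂ → ℝ≥0∞} (hH : Measurable H) (hG : Measurable G)
    {s : Set ℝ} (hs : MeasurableSet s)
    (h : ∀ r ∈ s, 0 < r → ∫⁻ θ in Ioo (-π) π, H (circleMap 0 r θ) ≤
      ∫⁻ θ in Ioo (-π) π, G (circleMap 0 r θ)) :
    ∫⁻ z in {z : ℂ | ‖z‖ ∈ s}, H z ≤ ∫⁻ z in {z : ℂ | ‖z‖ ∈ s}, G z := by
  rw [setLIntegral_norm_mem_eq_polar hH hs, setLIntegral_norm_mem_eq_polar hG hs]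
  refine setLIntegral_mono' measurableSet_Ioi fun r hr => ?_
  by_cases hrs : r ∈ s
  · exact mul_le_mul_right (mul_le_mul_right (h r hrs hr) _) _
  · simp [hrs]

theorem setIntegral_circleMap_eq {F : ℂ → ℂ} {c : ℂ} {r : ℝ} (hF : DiffContOnCl ℂ F (ball c r))
    (hr : 0 < r) : ∫ θ in Ioo (-π) π, F (circleMap c r θ) = (2 * π : ℝ) • F c := by
  have h1 := DiffContOnCl.circleAverage (f := F) (c := c) (R := r) (by rwa [abs_of_pos hr])
  have h2 : Function.Periodic (fun θ => F (circleMap c r θ)) (2 * π) := fun θ => by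
    simp only [periodic_circleMap c r θ]
  have h3 := h2.intervalIntegral_add_eq (-π) 0
  rw [show -π + 2 * π = π by ring, zero_add] at h3
  rw [← integral_Ioc_eq_integral_Ioo, ← intervalIntegral.integral_of_le (by linarith [Real.pi_pos]),
    h3, ← h1, Real.circleAverage, smul_smul, mul_inv_cancel₀ (by positivity), one_smul]

theorem continuous_comp_circleMap {F : ℂ → ℂ} {c : ℂ} {r R : ℝ} (hF : ContinuousOn F (ball c R))
    (hr : 0 < r) (hrR : r < R) : Continuous fun θ => F (circleMap c r θ) := by
  refine hF.comp_continuous (continuous_circleMap c r) fun θ => ?_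
  exact sphere_subset_ball hrR (circleMap_mem_sphere c hr.le θ)

theorem DifferentiableOn.diffContOnCl_smaller_ball {F : ℂ → ℂ} {c : ℂ} {r R : ℝ}
    (hF : DifferentiableOn ℂ F (ball c R)) (hrR : r < R) : DiffContOnCl ℂ F (ball c r) :=
  (hF.mono (closure_ball_subset_closedBall.trans (closedBall_subset_ball hrR))).diffContOnCl

theorem measurable_indicator_of_continuousOn {X E : Type*} [TopologicalSpace X] [MeasurableSpace X]
    [BorelSpace X] [TopologicalSpace E] [MeasurableSpace E] [BorelSpace E] [Zero E]
    {f : X → E} {s : Set X} (hf : ContinuousOn f s) (hs : MeasurableSet s) :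
    Measurable (s.indicator f) := by
  classical
  rw [← piecewise_eq_indicator]
  exact hf.measurable_piecewise continuousOn_const hs

theorem enorm_mul_volume_ball_zero_le {F : ℂ → ℂ} {R : ℝ}
    (hF : DifferentiableOn ℂ F (ball 0 R)) :
    ‖F 0‖ₑ * volume (ball (0 : ℂ) R) ≤ ∫⁻ z in ball 0 R, ‖F z‖ₑ := by
  have hb : ball (0 : ℂ) R = {z | ‖z‖ ∈ Iio R} := by ext; simp
  have hm : Measurable ((ball (0 : ℂ) R).indicator F) :=
    measurable_indicator_of_continuousOn hF.continuousOn measurableSet_ball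
  have h1 : ∫⁻ z in ball (0 : ℂ) R, ‖F z‖ₑ =
      ∫⁻ z in {z : ℂ | ‖z‖ ∈ Iio R}, ‖(ball (0 : ℂ) R).indicator F z‖ₑ := by
    rw [← hb]
    refine setLIntegral_congr_fun measurableSet_ball fun z hz => ?_
    simp only [indicator_of_mem hz]
  rw [h1, ← setLIntegral_const]
  nth_rw 1 [hb]
  refine setLIntegral_norm_mem_mono measurable_const hm.enorm measurableSet_Iio fun r hr hr0 => ?_
  have h2 : ∀ θ, (ball (0 : ℂ) R).indicator F (circleMap 0 r θ) = F (circleMap 0 r θ) := fun θ =>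
    indicator_of_mem (sphere_subset_ball hr (circleMap_mem_sphere 0 hr0.le θ)) _
  simp only [h2]
  refine le_trans (le_of_eq ?_) (enorm_integral_le_lintegral_enorm _)
  rw [setIntegral_circleMap_eq (hF.diffContOnCl_smaller_ball hr) hr0, enorm_smul,
    setLIntegral_const, Real.volume_Ioo, mul_comm, Real.enorm_of_nonneg (by positivity)]
  ring_nf

theorem setLIntegral_ball_eq_comp_add (H : ℂ → ℝ≥0∞) (c : ℂ) (R : ℝ) :
    ∫⁻ z in ball c R, H z = ∫⁻ z in ball 0 R, H (c + z) := by
  rw [← lintegral_indicator measurableSet_ball, ← lintegral_indicator measurableSet_ball,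
    ← lintegral_add_left_eq_self _ c]
  refine lintegral_congr fun z => ?_
  simp only [indicator, mem_ball, dist_self_add_left, dist_zero_right]

/-- The sub-mean value property of `|F|²` over a disc; it follows from the mean value property of
the holomorphic function `F²`. -/
theorem enorm_sq_mul_volume_ball_le {F : ℂ → ℂ} {c : ℂ} {R : ℝ}
    (hF : DifferentiableOn ℂ F (ball c R)) :
    ‖F c‖ₑ ^ 2 * volume (ball c R) ≤ ∫⁻ z in ball c R, ‖F z‖ₑ ^ 2 := by
  have h1 : DifferentiableOn ℂ (fun z => F (c + z) ^ 2) (ball 0 R) := by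
    refine (hF.comp (g := F) (f := fun z => c + z) (by fun_prop) fun z hz => ?_).pow 2
    simpa using hz
  have h2 := enorm_mul_volume_ball_zero_le h1
  rw [setLIntegral_ball_eq_comp_add]
  simpa [enorm_pow, Complex.volume_ball] using h2

/-- The mean value property of a positive harmonic function `Re G` over a radial set. -/
theorem setLIntegral_norm_mem_re_le {G : ℂ → ℂ} {R : ℝ} (hG : DifferentiableOn ℂ G (ball 0 R))
    (hpos : ∀ z ∈ ball (0 : ℂ) R, 0 ≤ (G z).re) {s : Set ℝ} (hs : MeasurableSet s)
    (hsR : s ⊆ Iio R) :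
    ∫⁻ z in {z : ℂ | ‖z‖ ∈ s}, ENNReal.ofReal (G z).re ≤
      ENNReal.ofReal (G 0).re * volume {z : ℂ | ‖z‖ ∈ s} := by
  have hm : Measurable ((ball (0 : ℂ) R).indicator G) :=
    measurable_indicator_of_continuousOn hG.continuousOn measurableSet_ball
  have h1 : ∫⁻ z in {z : ℂ | ‖z‖ ∈ s}, ENNReal.ofReal (G z).re =
      ∫⁻ z in {z : ℂ | ‖z‖ ∈ s}, ENNReal.ofReal ((ball (0 : ℂ) R).indicator G z).re := by
    refine setLIntegral_congr_fun (measurable_norm hs) fun z hz => ?_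
    have : z ∈ ball (0 : ℂ) R := by simpa using hsR hz
    simp only [indicator_of_mem this]
  rw [h1, ← setLIntegral_const]
  refine setLIntegral_norm_mem_mono (Complex.measurable_re.comp hm).ennreal_ofReal
    measurable_const hs fun r hr hr0 => ?_
  have hrR : r < R := hsR hr
  have hmem : ∀ θ, circleMap 0 r θ ∈ ball (0 : ℂ) R := fun θ =>
    sphere_subset_ball hrR (circleMap_mem_sphere 0 hr0.le θ)
  have h2 : ∀ θ, (ball (0 : ℂ) R).indicator G (circleMap 0 r θ) = G (circleMap 0 r θ) := fun θ =>
    indicator_of_mem (hmem θ) _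
  simp only [Function.comp_apply, h2]
  have hc := continuous_comp_circleMap hG.continuousOn hr0 hrR
  have hint : IntegrableOn (fun θ => G (circleMap 0 r θ)) (Ioo (-π) π) :=
    (hc.integrableOn_Icc (a := -π) (b := π)).mono_set Ioo_subset_Icc_self
  have h3 : ∫ θ in Ioo (-π) π, RCLike.re (G (circleMap 0 r θ)) = 2 * π * (G 0).re := by
    rw [integral_re hint, setIntegral_circleMap_eq (hG.diffContOnCl_smaller_ball hrR) hr0]
    simp
  have h4 : ∫⁻ θ in Ioo (-π) π, ENNReal.ofReal (G (circleMap 0 r θ)).re =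
      ENNReal.ofReal (2 * π * (G 0).re) := by
    rw [← h3]
    exact (ofReal_integral_eq_lintegral_ofReal hint.re (ae_of_all _ fun θ => hpos _ (hmem θ))).symm
  have h0 : 0 ≤ (G 0).re := hpos 0 (mem_ball_self (hr0.trans hrR))
  rw [h4]
  rw [setLIntegral_const, Real.volume_Ioo, ← ENNReal.ofReal_mul h0]
  ring_nf
  exact le_rfl

/-- The points of the unit disc at distance at most `t` from the unit circle. -/
def diskCollar (t : ℝ) : Set ℂ := {z | ‖z‖ ∈ Iio (1 : ℝ) ∩ Ici (1 - t)}

theorem measurableSet_diskCollar (t : ℝ) : MeasurableSet (diskCollar t) :=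
  measurable_norm (measurableSet_Iio.inter measurableSet_Ici)

theorem volume_diskCollar_le {t : ℝ} (ht : 0 ≤ t) :
    volume (diskCollar t) ≤ ENNReal.ofReal (2 * π * t) := by
  have hpi : (NNReal.pi : ℝ≥0∞) = ENNReal.ofReal π := by
    rw [← NNReal.coe_real_pi, ENNReal.ofReal_coe_nnreal]
  rcases le_total 1 t with h1 | h1
  · calc volume (diskCollar t) ≤ volume (ball (0 : ℂ) 1) :=
          measure_mono fun z hz => by simpa using hz.1
      _ = ENNReal.ofReal π := by rw [Complex.volume_ball, hpi]; simp
      _ ≤ _ := ENNReal.ofReal_le_ofReal (by nlinarith [Real.pi_pos])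
  · have hs : diskCollar t = ball (0 : ℂ) 1 \ ball 0 (1 - t) := by
      ext z; simp [diskCollar]
    rw [hs, measure_sdiff (ball_subset_ball (by linarith)) measurableSet_ball.nullMeasurableSet
      measure_ball_lt_top.ne, Complex.volume_ball, Complex.volume_ball, hpi,
      ← ENNReal.ofReal_pow zero_le_one, ← ENNReal.ofReal_pow (by linarith),
      ← ENNReal.ofReal_mul (by positivity), ← ENNReal.ofReal_mul (by positivity),
      ← ENNReal.ofReal_sub _ (by positivity)]
    exact ENNReal.ofReal_le_ofReal (by nlinarith [Real.pi_pos, mul_nonneg Real.pi_pos.le (sq_nonneg t)])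

/-- A holomorphic self-map of the disc which keeps the origin away from the unit circle satisfies
`1 - |g z| ≥ C (1 - |z|)`: the Schwarz lemma for the composition of `g` with the automorphism of
the disc taking `g 0` to `0`. -/
theorem one_sub_norm_ge_of_mapsTo_ball {g : ℂ → ℂ} (hg : DifferentiableOn ℂ g (ball 0 1))
    (hmaps : MapsTo g (ball 0 1) (ball 0 1)) {c : ℝ} (hc : ‖g 0‖ ≤ 1 - c) {z : ℂ} (hz : ‖z‖ < 1) :
    c / 4 * (1 - ‖z‖) ≤ 1 - ‖g z‖ := by
  have hlt : ∀ w, ‖w‖ < 1 → ‖g w‖ < 1 := fun w hw => by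
    simpa using hmaps (show w ∈ ball (0 : ℂ) 1 by simpa using hw)
  set a := g 0 with ha
  have ha1 : ‖a‖ < 1 := hlt 0 (by simp)
  have hden : ∀ w, ‖w‖ < 1 → 1 - conj a * g w ≠ 0 := fun w hw h0 => by
    have h1 : ‖conj a * g w‖ < 1 := by
      rw [norm_mul, RCLike.norm_conj]
      exact mul_lt_one_of_nonneg_of_lt_one_left (norm_nonneg _) ha1 (hlt w hw).le
    rw [← sub_eq_zero.1 h0] at h1
    simp at h1
  have hsq : ∀ w : ℂ, ‖1 - conj a * w‖ ^ 2 - ‖w - a‖ ^ 2 = (1 - ‖a‖ ^ 2) * (1 - ‖w‖ ^ 2) := by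
    intro w
    simp only [← Complex.normSq_eq_norm_sq, Complex.normSq_apply]
    simp
    ring
  have hS := Complex.norm_le_norm_of_mapsTo_ball (R := 1) (z := z)
    (f := fun w => (g w - a) / (1 - conj a * g w)) ?_ ?_ (by simp [ha]) hz
  · have h1 := hden z hz
    rw [norm_div, div_le_iff₀ (by simpa using h1)] at hS
    have h2 := hsq (g z)
    have h3 := hlt z hz
    have h5 : 1 - ‖a‖ * ‖g z‖ ≤ ‖1 - conj a * g z‖ := by
      have := norm_sub_norm_le 1 (conj a * g z)
      rwa [norm_mul, RCLike.norm_conj, norm_one] at this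
    have hA := norm_nonneg a
    have hG := norm_nonneg (g z)
    have hZ := norm_nonneg z
    have hD := norm_nonneg (1 - conj a * g z)
    have hN := norm_nonneg (g z - a)
    have h6 : ‖g z - a‖ ^ 2 ≤ ‖z‖ ^ 2 * ‖1 - conj a * g z‖ ^ 2 := by
      rw [← mul_pow]; exact pow_le_pow_left₀ hN hS 2
    have h7 : (1 - ‖a‖) ^ 2 ≤ ‖1 - conj a * g z‖ ^ 2 :=
      pow_le_pow_left₀ (by linarith) (by nlinarith) 2
    have h8 : (1 - ‖a‖) ^ 2 * (1 - ‖z‖) ≤ ‖1 - conj a * g z‖ ^ 2 * (1 - ‖z‖ ^ 2) :=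
      mul_le_mul h7 (by nlinarith) (by linarith) (sq_nonneg _)
    have h9 : (1 - ‖a‖ ^ 2) * (1 - ‖g z‖ ^ 2) ≤ (1 - ‖a‖) * (4 * (1 - ‖g z‖)) := by
      have e : (1 - ‖a‖ ^ 2) * (1 - ‖g z‖ ^ 2) =
          ((1 - ‖a‖) * (1 - ‖g z‖)) * ((1 + ‖a‖) * (1 + ‖g z‖)) := by ring
      rw [e]
      have : (1 + ‖a‖) * (1 + ‖g z‖) ≤ 4 := by nlinarith
      nlinarith [mul_nonneg (sub_nonneg.2 ha1.le) (sub_nonneg.2 h3.le)]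
    have h10 : (1 - ‖a‖) * ((1 - ‖a‖) * (1 - ‖z‖)) ≤ (1 - ‖a‖) * (4 * (1 - ‖g z‖)) := by
      nlinarith
    have h11 := le_of_mul_le_mul_left h10 (by linarith)
    nlinarith
  · refine DifferentiableOn.div (hg.sub_const _) ((hg.const_mul _).const_sub _) fun w hw => ?_
    exact hden w (by simpa using hw)
  · intro w hw
    have hw' : ‖w‖ < 1 := by simpa using hw
    have h1 : 0 < ‖1 - conj a * g w‖ := norm_pos_iff.2 (hden w hw')
    have h2 := hsq (g w)
    have h3 := hlt w hw'
    rw [mem_closedBall_zero_iff, norm_div, div_le_one h1]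
    refine le_of_sq_le_sq ?_ h1.le
    nlinarith [mul_nonneg (show 0 ≤ 1 - ‖a‖ ^ 2 by nlinarith [norm_nonneg a])
      (show 0 ≤ 1 - ‖g w‖ ^ 2 by nlinarith [norm_nonneg (g w)])]

/-- Level sets of a bounded holomorphic function are small on collars: the positive harmonic
function `Re ((1 + conj u * g) / (1 - conj u * g))` is at least `1 / (9 (1 - |u|))` where
`|g - u| < 1 - |u|`, and its mean over every circle is its value at the origin. -/
theorem volume_diskCollar_inter_le {g : ℂ → ℂ} (hg : DifferentiableOn ℂ g (ball 0 1))
    (hmaps : MapsTo g (ball 0 1) (ball 0 1)) {c : ℝ} (hc0 : 0 < c) (hc : ‖g 0‖ ≤ 1 - c) {u : ℂ}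
    (hu : ‖u‖ < 1) (t : ℝ) :
    volume (diskCollar t ∩ {z | ‖g z - u‖ < 1 - ‖u‖}) ≤
      ENNReal.ofReal (18 / c * (1 - ‖u‖)) * volume (diskCollar t) := by
  set δ := 1 - ‖u‖ with hδ
  have hδ0 : 0 < δ := by linarith
  have hu0 := norm_nonneg u
  have hlt : ∀ w, ‖w‖ < 1 → ‖g w‖ < 1 := fun w hw => by
    simpa using hmaps (show w ∈ ball (0 : ℂ) 1 by simpa using hw)
  have hlow : ∀ w, ‖w‖ < 1 → 1 - ‖g w‖ ≤ ‖1 - conj u * g w‖ := fun w hw => by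
    have h1 := norm_sub_norm_le 1 (conj u * g w)
    rw [norm_mul, RCLike.norm_conj, norm_one] at h1
    nlinarith [norm_nonneg (g w), hlt w hw]
  have hden : ∀ w, ‖w‖ < 1 → 0 < ‖1 - conj u * g w‖ := fun w hw => by
    linarith [hlow w hw, hlt w hw]
  set G : ℂ → ℂ := fun w => (1 + conj u * g w) / (1 - conj u * g w) with hG
  have hGd : DifferentiableOn ℂ G (ball 0 1) := by
    refine DifferentiableOn.div ((hg.const_mul _).const_add _) ((hg.const_mul _).const_sub _)
      fun w hw => norm_pos_iff.1 (hden w (by simpa using hw))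
  have hre : ∀ w, (G w).re = (1 - ‖conj u * g w‖ ^ 2) / ‖1 - conj u * g w‖ ^ 2 := by
    intro w
    simp only [hG]
    generalize conj u * g w = a
    rw [Complex.div_re, ← add_div, ← Complex.normSq_eq_norm_sq, ← Complex.normSq_eq_norm_sq]
    congr 1
    simp only [Complex.normSq_apply, Complex.add_re, Complex.sub_re, Complex.add_im,
      Complex.sub_im, Complex.one_re, Complex.one_im]
    ring
  have hpos : ∀ w ∈ ball (0 : ℂ) 1, 0 ≤ (G w).re := fun w hw => by
    have hw' : ‖w‖ < 1 := by simpa using hw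
    have h1 := hlt w hw'
    have h2 := norm_nonneg (g w)
    rw [hre, norm_mul, RCLike.norm_conj]
    have h3 : ‖u‖ * ‖g w‖ ≤ 1 := by nlinarith
    exact div_nonneg (by nlinarith [mul_nonneg hu0 h2]) (sq_nonneg _)
  have hG0 : (G 0).re ≤ 2 / c := by
    have h1 := hlow 0 (by simp)
    have h2 := hden 0 (by simp)
    have h3 := hlt 0 (by simp)
    have h4 := norm_nonneg (g 0)
    refine (Complex.re_le_norm _).trans ?_
    simp only [hG]
    rw [norm_div]
    refine div_le_div₀ zero_le_two ?_ hc0 (by linarith)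
    refine (norm_add_le _ _).trans ?_
    rw [norm_one, norm_mul, RCLike.norm_conj]
    nlinarith
  have hbig : ∀ w, ‖w‖ < 1 → ‖g w - u‖ < δ → 1 / (9 * δ) ≤ (G w).re := by
    intro w hw hd
    have h1 := hlt w hw
    have h2 := norm_nonneg (g w)
    have h3 : ‖1 - conj u * g w‖ ≤ 3 * δ := by
      have e : 1 - conj u * g w = ((1 - ‖u‖ ^ 2 : ℝ) : ℂ) + conj u * (u - g w) := by
        push_cast
        rw [mul_sub, Complex.conj_mul']
        ring
      rw [e]
      refine (norm_add_le _ _).trans ?_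
      rw [norm_mul, RCLike.norm_conj, norm_sub_rev u, Complex.norm_real,
        Real.norm_of_nonneg (by nlinarith)]
      nlinarith [norm_nonneg (g w - u)]
    rw [hre, norm_mul, RCLike.norm_conj, div_le_div_iff₀ (by positivity)
      (pow_pos (hden w hw) 2)]
    have h4 : ‖1 - conj u * g w‖ ^ 2 ≤ (3 * δ) ^ 2 := pow_le_pow_left₀ (norm_nonneg _) h3 2
    have h5 : ‖u‖ * ‖g w‖ ≤ ‖u‖ := by nlinarith
    have h6 : (‖u‖ * ‖g w‖) ^ 2 ≤ ‖u‖ ^ 2 := pow_le_pow_left₀ (by positivity) h5 2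
    have h7 : δ ≤ 1 - (‖u‖ * ‖g w‖) ^ 2 := by nlinarith
    nlinarith
  have hmain := setLIntegral_norm_mem_re_le hGd hpos
    (measurableSet_Iio.inter measurableSet_Ici : MeasurableSet (Iio (1 : ℝ) ∩ Ici (1 - t)))
    inter_subset_left
  change ∫⁻ z in diskCollar t, _ ≤ _ * volume (diskCollar t) at hmain
  have h1 : ENNReal.ofReal (1 / (9 * δ)) * volume (diskCollar t ∩ {z | ‖g z - u‖ < δ}) ≤
      ∫⁻ z in diskCollar t, ENNReal.ofReal (G z).re := by
    rw [← setLIntegral_const]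
    have hsub : diskCollar t ∩ {z | ‖g z - u‖ < δ} ⊆ diskCollar t := inter_subset_left
    have hmeas : MeasurableSet (diskCollar t ∩ {z | ‖g z - u‖ < δ}) := by
      have h2 : diskCollar t ∩ {z | ‖g z - u‖ < δ} =
          diskCollar t ∩ (ball 0 1 ∩ (fun z => ‖g z - u‖) ⁻¹' Iio δ) := by
        ext z
        constructor
        · rintro ⟨h, h'⟩
          exact ⟨h, by simpa using h.1, h'⟩
        · rintro ⟨h, -, h'⟩
          exact ⟨h, h'⟩
      rw [h2]
      exact (measurableSet_diskCollar t).inter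
        (((hg.continuousOn.sub continuousOn_const).norm).isOpen_inter_preimage isOpen_ball
          isOpen_Iio).measurableSet
    refine (setLIntegral_mono' hmeas fun w hw => ?_).trans (lintegral_mono_set hsub)
    exact ENNReal.ofReal_le_ofReal (hbig w hw.1.1 hw.2)
  have h2 : ENNReal.ofReal (1 / (9 * δ)) * volume (diskCollar t ∩ {z | ‖g z - u‖ < δ}) ≤
      ENNReal.ofReal (2 / c) * volume (diskCollar t) :=
    (h1.trans hmain).trans (by gcongr)
  calc _ = ENNReal.ofReal (9 * δ) * (ENNReal.ofReal (1 / (9 * δ)) *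
        volume (diskCollar t ∩ {z | ‖g z - u‖ < δ})) := by
        rw [← mul_assoc, ← ENNReal.ofReal_mul (by positivity), mul_one_div_cancel (by positivity),
          ENNReal.ofReal_one, one_mul]
    _ ≤ ENNReal.ofReal (9 * δ) * (ENNReal.ofReal (2 / c) * volume (diskCollar t)) := by gcongr
    _ = _ := by
        rw [← mul_assoc, ← ENNReal.ofReal_mul (by positivity)]
        congr 2
        ring

/-! ### The weighted norm inequality -/

theorem mem_bidisc_iff {z : ℂ × ℂ} : z ∈ bidisc ↔ ‖z.1‖ < 1 ∧ ‖z.2‖ < 1 := by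
  simp [bidisc, mem_prod]

theorem measurableSet_bidisc : MeasurableSet bidisc := isOpen_bidisc.measurableSet

/-- The sub-mean value property of `|F|²` over polydiscs. -/
theorem enorm_sq_mul_volume_polydisc_le {F : ℂ × ℂ → ℂ} {w : ℂ × ℂ} {r₁ r₂ : ℝ} (hr₂ : 0 < r₂)
    (hF : DifferentiableOn ℂ F (ball w.1 r₁ ×ˢ ball w.2 r₂)) :
    ‖F w‖ₑ ^ 2 * (volume (ball w.1 r₁) * volume (ball w.2 r₂)) ≤
      ∫⁻ z in ball w.1 r₁ ×ˢ ball w.2 r₂, ‖F z‖ₑ ^ 2 := by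
  have hm : AEMeasurable (fun z => ‖F z‖ₑ ^ 2)
      ((volume.prod volume).restrict (ball w.1 r₁ ×ˢ ball w.2 r₂)) :=
    ((hF.continuousOn.aemeasurable
      (measurableSet_ball.prod measurableSet_ball)).enorm).pow_const 2
  rw [Measure.volume_eq_prod, setLIntegral_prod _ hm]
  rcases le_or_gt r₁ 0 with hr₁ | hr₁
  · simp [ball_eq_empty.2 hr₁]
  have h1 : DifferentiableOn ℂ (fun x => F (x, w.2)) (ball w.1 r₁) :=
    hF.comp (by fun_prop) fun x hx => ⟨hx, mem_ball_self hr₂⟩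
  have h2 : ∀ x ∈ ball w.1 r₁, ‖F (x, w.2)‖ₑ ^ 2 * volume (ball w.2 r₂) ≤
      ∫⁻ y in ball w.2 r₂, ‖F (x, y)‖ₑ ^ 2 := fun x hx =>
    enorm_sq_mul_volume_ball_le (F := fun y => F (x, y))
      (hF.comp (by fun_prop) fun y hy => ⟨hx, hy⟩)
  calc ‖F w‖ₑ ^ 2 * (volume (ball w.1 r₁) * volume (ball w.2 r₂)) =
      (‖F (w.1, w.2)‖ₑ ^ 2 * volume (ball w.1 r₁)) * volume (ball w.2 r₂) := by rw [mul_assoc]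
    _ ≤ (∫⁻ x in ball w.1 r₁, ‖F (x, w.2)‖ₑ ^ 2) * volume (ball w.2 r₂) := by
        gcongr; exact enorm_sq_mul_volume_ball_le h1
    _ = ∫⁻ x in ball w.1 r₁, ‖F (x, w.2)‖ₑ ^ 2 * volume (ball w.2 r₂) :=
        (lintegral_mul_const' _ _ measure_ball_lt_top.ne).symm
    _ ≤ _ := setLIntegral_mono' measurableSet_ball h2

/-- A bounded holomorphic function on the bidisc whose modulus stays away from `1` on both
coordinate discs is close to a point `u` near the unit circle only on a set of volume
`O((1 - |u|)³)`: both coordinates have to be within `O(1 - |u|)` of the unit circle, and a third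
factor comes from the size of level sets on each slice. -/
theorem volume_near_point_le {g : ℂ × ℂ → ℂ} (hg : DifferentiableOn ℂ g bidisc)
    (hmaps : MapsTo g bidisc (ball 0 1)) {c : ℝ} (hc0 : 0 < c)
    (h₁ : ∀ z : ℂ, ‖z‖ < 1 → ‖g (z, 0)‖ ≤ 1 - c) (h₂ : ∀ z : ℂ, ‖z‖ < 1 → ‖g (0, z)‖ ≤ 1 - c)
    {u : ℂ} (hu : ‖u‖ < 1) :
    volume {z | z ∈ bidisc ∧ ‖g z - u‖ < 1 - ‖u‖} ≤
      ENNReal.ofReal (18 / c * (2 * π * (8 / c)) ^ 2 * (1 - ‖u‖) ^ 3) := by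
  set δ := 1 - ‖u‖ with hδ
  have hδ0 : 0 < δ := by linarith
  set t := 8 / c * δ with ht
  have ht0 : 0 ≤ t := by positivity
  have hmeas : MeasurableSet {z | z ∈ bidisc ∧ ‖g z - u‖ < δ} :=
    (((hg.continuousOn.sub continuousOn_const).norm).isOpen_inter_preimage isOpen_bidisc
      isOpen_Iio).measurableSet
  have hd₁ : ∀ y : ℂ, ‖y‖ < 1 → DifferentiableOn ℂ (fun x => g (x, y)) (ball 0 1) := fun y hy =>
    hg.comp (by fun_prop) fun x hx => mem_bidisc_iff.2 ⟨by simpa using hx, hy⟩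
  have hd₂ : ∀ x : ℂ, ‖x‖ < 1 → DifferentiableOn ℂ (fun y => g (x, y)) (ball 0 1) := fun x hx =>
    hg.comp (by fun_prop) fun y hy => mem_bidisc_iff.2 ⟨hx, by simpa using hy⟩
  have hm₁ : ∀ y : ℂ, ‖y‖ < 1 → MapsTo (fun x => g (x, y)) (ball 0 1) (ball 0 1) := fun y hy x hx =>
    hmaps (mem_bidisc_iff.2 ⟨by simpa using hx, hy⟩)
  have hm₂ : ∀ x : ℂ, ‖x‖ < 1 → MapsTo (fun y => g (x, y)) (ball 0 1) (ball 0 1) := fun x hx y hy =>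
    hmaps (mem_bidisc_iff.2 ⟨hx, by simpa using hy⟩)
  have hcollar : ∀ z ∈ {z | z ∈ bidisc ∧ ‖g z - u‖ < δ}, z.1 ∈ diskCollar t ∧ z.2 ∈ diskCollar t := by
    rintro ⟨x, y⟩ ⟨hz, hzu⟩
    obtain ⟨hx, hy⟩ := mem_bidisc_iff.1 hz
    change ‖x‖ < 1 at hx
    change ‖y‖ < 1 at hy
    have h3 := one_sub_norm_ge_of_mapsTo_ball (hd₁ y hy) (hm₁ y hy) (h₂ y hy) hx
    have h4 := one_sub_norm_ge_of_mapsTo_ball (hd₂ x hx) (hm₂ x hx) (h₁ x hx) hy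
    have h5 : 1 - ‖g (x, y)‖ ≤ 2 * δ := by
      have := norm_sub_norm_le u (g (x, y))
      rw [norm_sub_rev] at this
      linarith
    have h6 : ∀ s : ℝ, c / 4 * s ≤ 2 * δ → s ≤ t := fun s hs => by
      rw [ht, div_mul_eq_mul_div, le_div_iff₀ hc0]; linarith
    have h7 := h6 _ (h3.trans h5)
    have h8 := h6 _ (h4.trans h5)
    exact ⟨⟨hx, by simpa using by linarith⟩, ⟨hy, by simpa using by linarith⟩⟩
  rw [Measure.volume_eq_prod, Measure.prod_apply hmeas]
  have hslice : ∀ x : ℂ, volume (Prod.mk x ⁻¹' {z | z ∈ bidisc ∧ ‖g z - u‖ < δ}) ≤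
      (diskCollar t).indicator
        (fun _ => ENNReal.ofReal (18 / c * δ) * volume (diskCollar t)) x := by
    intro x
    by_cases hx : x ∈ diskCollar t
    · rw [indicator_of_mem hx]
      have hx1 : ‖x‖ < 1 := hx.1
      refine le_trans (measure_mono ?_) (volume_diskCollar_inter_le (hd₂ x hx1) (hm₂ x hx1) hc0
        (h₁ x hx1) hu t)
      intro y hy
      exact ⟨(hcollar _ hy).2, hy.2⟩
    · rw [indicator_of_notMem hx, nonpos_iff_eq_zero]
      refine measure_mono_null (fun y hy => ?_) measure_empty
      exact hx (hcollar _ hy).1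
  refine (lintegral_mono hslice).trans ?_
  rw [lintegral_indicator (measurableSet_diskCollar t), setLIntegral_const]
  calc _ ≤ ENNReal.ofReal (18 / c * δ) * ENNReal.ofReal (2 * π * t) * ENNReal.ofReal (2 * π * t) := by
        gcongr <;> exact volume_diskCollar_le ht0
    _ = _ := by
        rw [← ENNReal.ofReal_mul (by positivity), ← ENNReal.ofReal_mul (by positivity), ht]
        congr 1; ring

/-- The pairs `(z, u)` for which both coordinates of `φ z` are closer to those of `u` than `u` is
to the two unit circles. -/
def nearPairs (φ : ℂ × ℂ → ℂ × ℂ) : Set ((ℂ × ℂ) × (ℂ × ℂ)) :=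
  {p | (p.1 ∈ bidisc ∧ p.2 ∈ bidisc) ∧
    ‖(φ p.1).1 - p.2.1‖ < 1 - ‖p.2.1‖ ∧ ‖(φ p.1).2 - p.2.2‖ < 1 - ‖p.2.2‖}

theorem measurableSet_nearPairs {φ : ℂ × ℂ → ℂ × ℂ} (hφ : ContinuousOn φ bidisc) :
    MeasurableSet (nearPairs φ) := by
  have hc : ContinuousOn (fun p : (ℂ × ℂ) × (ℂ × ℂ) => φ p.1) (bidisc ×ˢ bidisc) :=
    hφ.comp continuousOn_fst fun p hp => hp.1
  have hf : ContinuousOn (fun p : (ℂ × ℂ) × (ℂ × ℂ) =>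
      (‖(φ p.1).1 - p.2.1‖ - (1 - ‖p.2.1‖), ‖(φ p.1).2 - p.2.2‖ - (1 - ‖p.2.2‖)))
      (bidisc ×ˢ bidisc) := by
    have hc₁ := hc.fst
    have hc₂ := hc.snd
    exact ((hc₁.sub (by fun_prop)).norm.sub (by fun_prop)).prodMk
      ((hc₂.sub (by fun_prop)).norm.sub (by fun_prop))
  have h := hf.isOpen_inter_preimage (isOpen_bidisc.prod isOpen_bidisc)
    ((isOpen_Iio (a := (0 : ℝ))).prod (isOpen_Iio (a := (0 : ℝ))))
  convert h.measurableSet using 1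
  ext p
  simp [nearPairs, mem_prod]

/-- The disc of radius `(1 - |a|) / 2` centred at `a` has area at least `π (1 - |u|)² / 9` for each of
its points `u`, because `1 - |u| ≤ 3 (1 - |a|) / 2` there. -/
theorem one_le_volume_ball_mul {a u : ℂ} (ha : ‖a‖ < 1) (hu : u ∈ ball a ((1 - ‖a‖) / 2)) :
    1 ≤ volume (ball a ((1 - ‖a‖) / 2)) * ENNReal.ofReal (9 / (π * (1 - ‖u‖) ^ 2)) := by
  have hpi : (NNReal.pi : ℝ≥0∞) = ENNReal.ofReal π := by
    rw [← NNReal.coe_real_pi, ENNReal.ofReal_coe_nnreal]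
  rw [mem_ball, dist_eq_norm] at hu
  have h1 : 1 - ‖u‖ ≤ 3 * ((1 - ‖a‖) / 2) := by
    have := norm_sub_norm_le a u
    rw [norm_sub_rev] at this
    linarith
  have h2 : 0 < 1 - ‖u‖ := by
    have := norm_sub_norm_le u a
    linarith
  rw [Complex.volume_ball, hpi, ← ENNReal.ofReal_pow (by linarith),
    ← ENNReal.ofReal_mul (by positivity), ← ENNReal.ofReal_mul (by positivity),
    ENNReal.one_le_ofReal]
  have h3 : (1 - ‖u‖) ^ 2 ≤ (3 * ((1 - ‖a‖) / 2)) ^ 2 := pow_le_pow_left₀ h2.le h1 2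
  rw [mul_div_assoc', le_div_iff₀ (by positivity)]
  nlinarith [Real.pi_pos]

/-- A pointwise bound for `|F|²` by a weighted integral over the points close to `φ z`. -/
theorem enorm_sq_comp_le_lintegral_nearPairs {φ : ℂ × ℂ → ℂ × ℂ} (hmaps : MapsTo φ bidisc bidisc)
    {F : ℂ × ℂ → ℂ} (hF : DifferentiableOn ℂ F bidisc) {z : ℂ × ℂ} (hz : z ∈ bidisc) :
    ‖F (φ z)‖ₑ ^ 2 ≤ ∫⁻ u in bidisc, (nearPairs φ).indicator 1 (z, u) *
      (ENNReal.ofReal (9 / (π * (1 - ‖u.1‖) ^ 2)) * ENNReal.ofReal (9 / (π * (1 - ‖u.2‖) ^ 2)) *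
        ‖F u‖ₑ ^ 2) := by
  set w := φ z with hw
  obtain ⟨h1, h2⟩ := mem_bidisc_iff.1 (hmaps hz)
  rw [← hw] at h1 h2
  set r₁ := (1 - ‖w.1‖) / 2 with hr₁
  set r₂ := (1 - ‖w.2‖) / 2 with hr₂
  have hr₁0 : 0 < r₁ := by linarith
  have hr₂0 : 0 < r₂ := by linarith
  have hsub : ∀ a b : ℂ, b ∈ ball a ((1 - ‖a‖) / 2) → ‖a - b‖ < 1 - ‖b‖ := fun a b hb => by
    rw [mem_ball, dist_eq_norm] at hb
    have := norm_sub_norm_le b a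
    rw [norm_sub_rev a b]
    linarith
  have hQ : ball w.1 r₁ ×ˢ ball w.2 r₂ ⊆ bidisc := fun u hu => by
    have h3 := (norm_nonneg _).trans_lt (hsub _ _ hu.1)
    have h4 := (norm_nonneg _).trans_lt (hsub _ _ hu.2)
    exact mem_bidisc_iff.2 ⟨by linarith, by linarith⟩
  have hmean := enorm_sq_mul_volume_polydisc_le hr₂0 (hF.mono hQ)
  set v := volume (ball w.1 r₁) * volume (ball w.2 r₂) with hv
  have hv0 : v ≠ 0 := mul_ne_zero (measure_ball_pos _ _ hr₁0).ne' (measure_ball_pos _ _ hr₂0).ne'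
  have hvtop : v ≠ ∞ := ENNReal.mul_ne_top measure_ball_lt_top.ne measure_ball_lt_top.ne
  have hmeasQ : MeasurableSet (ball w.1 r₁ ×ˢ ball w.2 r₂) :=
    measurableSet_ball.prod measurableSet_ball
  calc ‖F w‖ₑ ^ 2 = v⁻¹ * (‖F w‖ₑ ^ 2 * v) := by
        rw [mul_comm (‖F w‖ₑ ^ 2), ← mul_assoc, ENNReal.inv_mul_cancel hv0 hvtop, one_mul]
    _ ≤ v⁻¹ * ∫⁻ u in ball w.1 r₁ ×ˢ ball w.2 r₂, ‖F u‖ₑ ^ 2 := by gcongr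
    _ = ∫⁻ u in ball w.1 r₁ ×ˢ ball w.2 r₂, v⁻¹ * ‖F u‖ₑ ^ 2 :=
        (lintegral_const_mul' _ _ (ENNReal.inv_ne_top.2 hv0)).symm
    _ ≤ ∫⁻ u in ball w.1 r₁ ×ˢ ball w.2 r₂, (nearPairs φ).indicator 1 (z, u) *
          (ENNReal.ofReal (9 / (π * (1 - ‖u.1‖) ^ 2)) *
            ENNReal.ofReal (9 / (π * (1 - ‖u.2‖) ^ 2)) * ‖F u‖ₑ ^ 2) := by
        refine setLIntegral_mono' hmeasQ fun u hu => ?_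
        have hmem : (z, u) ∈ nearPairs φ :=
          ⟨⟨hz, hQ hu⟩, hsub _ _ hu.1, hsub _ _ hu.2⟩
        rw [indicator_of_mem hmem, Pi.one_apply, one_mul]
        gcongr
        rw [ENNReal.inv_le_iff_le_mul (fun _ => hv0) (fun h => absurd h hvtop), hv,
          mul_mul_mul_comm]
        exact one_le_mul (one_le_volume_ball_mul h1 hu.1) (one_le_volume_ball_mul h2 hu.2)
    _ ≤ _ := lintegral_mono_set hQ

/-- The weight obtained by integrating the kernel of `enorm_sq_comp_le_lintegral_nearPairs` over
`z` is at most a constant times the distance to the boundary of the bidisc: where it is nonzero, one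
coordinate of `u` stays away from the unit circle, and the cubic volume bound for the other one
outweighs the square in the denominator. -/
theorem volume_nearPairs_slice_mul_le {φ : ℂ × ℂ → ℂ × ℂ} {c C : ℝ} (hc0 : 0 < c) (hc1 : c ≤ 1)
    (hC : 0 ≤ C)
    (h : ∀ z ∈ bidisc, ‖(φ z).1‖ ≤ 1 - c ∨ ‖(φ z).2‖ ≤ 1 - c)
    (hV₁ : ∀ u : ℂ, ‖u‖ < 1 → volume {z | z ∈ bidisc ∧ ‖(φ z).1 - u‖ < 1 - ‖u‖} ≤
      ENNReal.ofReal (C * (1 - ‖u‖) ^ 3))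
    (hV₂ : ∀ u : ℂ, ‖u‖ < 1 → volume {z | z ∈ bidisc ∧ ‖(φ z).2 - u‖ < 1 - ‖u‖} ≤
      ENNReal.ofReal (C * (1 - ‖u‖) ^ 3))
    {u : ℂ × ℂ} (hu : u ∈ bidisc) :
    ENNReal.ofReal (9 / (π * (1 - ‖u.1‖) ^ 2)) * ENNReal.ofReal (9 / (π * (1 - ‖u.2‖) ^ 2)) *
      volume {z | (z, u) ∈ nearPairs φ} ≤
      ENNReal.ofReal (648 * C / (π ^ 2 * c ^ 3)) * ENNReal.ofReal (1 - ‖u‖) := by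
  obtain ⟨hu1, hu2⟩ := mem_bidisc_iff.1 hu
  rcases eq_empty_or_nonempty {z | (z, u) ∈ nearPairs φ} with he | ⟨z, ⟨hz, -⟩, hz1, hz2⟩
  · simp [he]
  -- the numerical estimate, where `a` and `b` are the two numbers `1 - |u_j|` and the coordinate
  -- belonging to `a` is the one that stays away from the unit circle
  have key : ∀ a b m : ℝ, c / 2 < a → a ≤ 1 → 0 < b → b ≤ 1 → (a ≤ m ∨ b ≤ m) →
      9 / (π * a ^ 2) * (9 / (π * b ^ 2)) * (C * b ^ 3) ≤ 648 * C / (π ^ 2 * c ^ 3) * m := by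
    intro a b m ha ha1 hb hb1 hm
    have ha0 : 0 < a := by linarith
    have hbm : c / 2 * b ≤ m := by
      rcases hm with hm | hm <;> nlinarith
    have h1 : 9 / (π * a ^ 2) * (9 / (π * b ^ 2)) * (C * b ^ 3) = 81 * C / π ^ 2 * (b / a ^ 2) := by
      field_simp; ring
    have h2 : 648 * C / (π ^ 2 * c ^ 3) * m = 81 * C / π ^ 2 * (8 * m / c ^ 3) := by
      field_simp; ring
    rw [h1, h2]
    refine mul_le_mul_of_nonneg_left ?_ (by positivity)
    rw [div_le_div_iff₀ (by positivity) (by positivity)]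
    have h3 : (c / 2) ^ 2 ≤ a ^ 2 := pow_le_pow_left₀ (by positivity) ha.le 2
    have h4 : 0 ≤ m := le_trans (by positivity) hbm
    nlinarith [mul_le_mul hbm h3 (by positivity) h4]
  have hnorm : ‖u‖ = max ‖u.1‖ ‖u.2‖ := rfl
  have hm : 1 - ‖u.1‖ ≤ 1 - ‖u‖ ∨ 1 - ‖u.2‖ ≤ 1 - ‖u‖ := by
    rcases max_choice ‖u.1‖ ‖u.2‖ with h' | h' <;> rw [hnorm, h'] <;> simp
  have n1 := norm_nonneg u.1
  have n2 := norm_nonneg u.2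
  rcases h z hz with h' | h'
  · have h3 := norm_sub_norm_le u.1 (φ z).1
    rw [norm_sub_rev] at h3
    simp only at hz1
    calc _ ≤ ENNReal.ofReal (9 / (π * (1 - ‖u.1‖) ^ 2)) *
          ENNReal.ofReal (9 / (π * (1 - ‖u.2‖) ^ 2)) * ENNReal.ofReal (C * (1 - ‖u.2‖) ^ 3) := by
          gcongr
          refine le_trans (measure_mono ?_) (hV₂ u.2 hu2)
          exact fun z hz => ⟨hz.1.1, hz.2.2⟩
      _ ≤ _ := by
          rw [← ENNReal.ofReal_mul (by positivity), ← ENNReal.ofReal_mul (by positivity),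
            ← ENNReal.ofReal_mul (by positivity)]
          exact ENNReal.ofReal_le_ofReal (key _ _ _ (by linarith) (by linarith) (by linarith)
            (by linarith) hm)
  · have h3 := norm_sub_norm_le u.2 (φ z).2
    rw [norm_sub_rev] at h3
    simp only at hz2
    calc _ ≤ ENNReal.ofReal (9 / (π * (1 - ‖u.1‖) ^ 2)) *
          ENNReal.ofReal (9 / (π * (1 - ‖u.2‖) ^ 2)) * ENNReal.ofReal (C * (1 - ‖u.1‖) ^ 3) := by
          gcongr
          refine le_trans (measure_mono ?_) (hV₁ u.1 hu1)
          exact fun z hz => ⟨hz.1.1, hz.2.1⟩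
      _ ≤ _ := by
          rw [mul_comm (ENNReal.ofReal (9 / (π * (1 - ‖u.1‖) ^ 2))),
            ← ENNReal.ofReal_mul (by positivity), ← ENNReal.ofReal_mul (by positivity),
            ← ENNReal.ofReal_mul (by positivity)]
          exact ENNReal.ofReal_le_ofReal (key _ _ _ (by linarith) (by linarith) (by linarith)
            (by linarith) hm.symm)

/-- The Carleson-type inequality behind compactness: `f ∘ φ` is controlled by `f` with a weight
which vanishes at the boundary of the bidisc. -/
theorem exists_lintegral_comp_le {φ : ℂ × ℂ → ℂ × ℂ} (hmaps : MapsTo φ bidisc bidisc)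
    (hφ : DifferentiableOn ℂ φ bidisc) {c : ℝ} (hc0 : 0 < c) (hc1 : c ≤ 1)
    (h₁ : ∀ z : ℂ, ‖z‖ < 1 → ‖φ (z, 0)‖ ≤ 1 - c) (h₂ : ∀ z : ℂ, ‖z‖ < 1 → ‖φ (0, z)‖ ≤ 1 - c)
    (h : ∀ z ∈ bidisc, ‖(φ z).1‖ ≤ 1 - c ∨ ‖(φ z).2‖ ≤ 1 - c) :
    ∃ A : ℝ, ∀ F : ℂ × ℂ → ℂ, DifferentiableOn ℂ F bidisc →
      ∫⁻ z in bidisc, ‖F (φ z)‖ₑ ^ 2 ≤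
        ENNReal.ofReal A * ∫⁻ u in bidisc, ENNReal.ofReal (1 - ‖u‖) * ‖F u‖ₑ ^ 2 := by
  set C := 18 / c * (2 * π * (8 / c)) ^ 2 with hC
  have hV₁ := fun (u : ℂ) (hu : ‖u‖ < 1) => volume_near_point_le (g := fun z => (φ z).1) hφ.fst
    (fun z hz => (hmaps hz).1) hc0 (fun z hz => (norm_fst_le _).trans (h₁ z hz))
    (fun z hz => (norm_fst_le _).trans (h₂ z hz)) hu
  have hV₂ := fun (u : ℂ) (hu : ‖u‖ < 1) => volume_near_point_le (g := fun z => (φ z).2) hφ.snd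
    (fun z hz => (hmaps hz).2) hc0 (fun z hz => (norm_snd_le _).trans (h₁ z hz))
    (fun z hz => (norm_snd_le _).trans (h₂ z hz)) hu
  refine ⟨648 * C / (π ^ 2 * c ^ 3), fun F hF => ?_⟩
  set W : ℂ × ℂ → ℝ≥0∞ := fun u => ENNReal.ofReal (9 / (π * (1 - ‖u.1‖) ^ 2)) *
    ENNReal.ofReal (9 / (π * (1 - ‖u.2‖) ^ 2)) with hW
  have hWm : Measurable W := by
    rw [hW]; fun_prop
  have hE := measurableSet_nearPairs hφ.continuousOn
  have hind : Measurable ((nearPairs φ).indicator (1 : (ℂ × ℂ) × (ℂ × ℂ) → ℝ≥0∞)) := measurable_one.indicator hE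
  have hFm : Measurable (bidisc.indicator F) :=
    measurable_indicator_of_continuousOn hF.continuousOn measurableSet_bidisc
  calc ∫⁻ z in bidisc, ‖F (φ z)‖ₑ ^ 2 ≤
      ∫⁻ z in bidisc, ∫⁻ u in bidisc, (nearPairs φ).indicator 1 (z, u) *
        (W u * ‖bidisc.indicator F u‖ₑ ^ 2) := by
        refine setLIntegral_mono' measurableSet_bidisc fun z hz => ?_
        refine (enorm_sq_comp_le_lintegral_nearPairs hmaps hF hz).trans (le_of_eq ?_)
        refine setLIntegral_congr_fun measurableSet_bidisc fun u hu => ?_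
        simp only [hW, indicator_of_mem hu]
    _ = ∫⁻ u in bidisc, ∫⁻ z in bidisc, (nearPairs φ).indicator 1 (z, u) *
        (W u * ‖bidisc.indicator F u‖ₑ ^ 2) := by
        refine lintegral_lintegral_swap (Measurable.aemeasurable ?_)
        exact hind.mul ((hWm.comp measurable_snd).mul ((hFm.comp measurable_snd).enorm.pow_const 2))
    _ ≤ ∫⁻ u in bidisc, ENNReal.ofReal (648 * C / (π ^ 2 * c ^ 3)) *
        (ENNReal.ofReal (1 - ‖u‖) * ‖F u‖ₑ ^ 2) := by
        refine setLIntegral_mono' measurableSet_bidisc fun u hu => ?_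
        have hs : MeasurableSet {z | (z, u) ∈ nearPairs φ} := measurable_prodMk_right hE
        have h3 : ∫⁻ z in bidisc, (nearPairs φ).indicator 1 (z, u) ≤
            volume {z | (z, u) ∈ nearPairs φ} := by
          refine (setLIntegral_le_lintegral _ _).trans (le_of_eq ?_)
          rw [← lintegral_indicator_one hs]
          rfl
        have hmu : Measurable fun z => (nearPairs φ).indicator (1 : (ℂ × ℂ) × (ℂ × ℂ) → ℝ≥0∞) (z, u) :=
          hind.comp measurable_prodMk_right
        rw [lintegral_mul_const _ hmu, indicator_of_mem hu,
          ← mul_assoc, ← mul_assoc (ENNReal.ofReal (648 * C / (π ^ 2 * c ^ 3)))]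
        refine mul_le_mul' (le_trans ?_ (volume_nearPairs_slice_mul_le hc0 hc1 (by positivity) h hV₁ hV₂ hu))
          le_rfl
        rw [mul_comm]
        gcongr
    _ = _ := lintegral_const_mul' _ _ ENNReal.ofReal_ne_top

/-! ### Montel's theorem in several variables -/

/-- A locally uniform limit of holomorphic functions of several variables is holomorphic: by the
Schwarz lemma the derivatives form a uniform Cauchy sequence near every point. -/
theorem differentiableOn_of_tendstoLocallyUniformlyOn {E : Type*} [NormedAddCommGroup E]
    [NormedSpace ℂ E] [ProperSpace E] {F : ℕ → E → ℂ} {g : E → ℂ} {U : Set E} (hU : IsOpen U)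
    (hF : ∀ n, DifferentiableOn ℂ (F n) U) (h : TendstoLocallyUniformlyOn F g atTop U) :
    DifferentiableOn ℂ g U := by
  intro x hx
  obtain ⟨R, hR, hRU⟩ := Metric.isOpen_iff.1 hU x hx
  set r := R / 4 with hr
  have hr0 : 0 < r := by positivity
  have hsub : closedBall x (2 * r) ⊆ U :=
    (closedBall_subset_ball (by rw [hr]; linarith)).trans hRU
  have hunif : TendstoUniformlyOn F g atTop (closedBall x (2 * r)) :=
    (tendstoLocallyUniformlyOn_iff_forall_isCompact hU).1 h _ hsub (isCompact_closedBall _ _)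
  have hball : ∀ y ∈ ball x r, ball y r ⊆ closedBall x (2 * r) := fun y hy z hz => by
    have h1 := dist_triangle z y x
    rw [mem_ball] at hy hz
    rw [mem_closedBall]
    linarith
  have hcauchy : UniformCauchySeqOn (fun n => fderiv ℂ (F n)) atTop (ball x r) := by
    have hu := hunif.uniformCauchySeqOn
    rw [Metric.uniformCauchySeqOn_iff] at hu ⊢
    intro ε hε
    obtain ⟨N, hN⟩ := hu (ε * r / 4) (by positivity)
    refine ⟨N, fun m hm n hn y hy => ?_⟩
    have hyU : y ∈ U := hsub (hball y hy (mem_ball_self hr0))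
    have hd : ∀ k, DifferentiableAt ℂ (F k) y := fun k =>
      (hF k).differentiableAt (hU.mem_nhds hyU)
    have h1 := Complex.norm_fderiv_le_div_of_mapsTo_ball (f := fun z => F m z - F n z) (c := y)
      (R₁ := r) (R₂ := ε * r / 2)
      (((hF m).sub (hF n)).mono ((hball y hy).trans hsub)) (fun z hz => ?_) hr0
    · rw [fderiv_fun_sub (hd m) (hd n), ← dist_eq_norm] at h1
      refine h1.trans_lt ?_
      rw [div_lt_iff₀ hr0]
      nlinarith [mul_pos hε hr0]
    · have h2 := hN m hm n hn z (hball y hy hz)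
      have h3 := hN m hm n hn y (hball y hy (mem_ball_self hr0))
      rw [dist_eq_norm] at h2 h3
      rw [mem_closedBall, dist_eq_norm]
      refine (norm_sub_le _ _).trans ?_
      linarith
  have hlim : ∀ y ∈ ball x r, ∃ L, Tendsto (fun n => fderiv ℂ (F n) y) atTop (𝓝 L) := fun y hy =>
    cauchySeq_tendsto_of_complete (hcauchy.cauchySeq hy)
  choose! g' hg' using hlim
  have hmem : ∀ y ∈ ball x r, y ∈ U := fun y hy => hsub (hball y hy (mem_ball_self hr0))
  exact (hasFDerivAt_of_tendstoUniformlyOn isOpen_ball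
    (hcauchy.tendstoUniformlyOn_of_tendsto hg')
    (fun n y hy => ((hF n).differentiableAt (hU.mem_nhds (hmem y hy))).hasFDerivAt)
    (fun y hy => (h.tendsto_at (hmem y hy)))
    (mem_ball_self hr0)).differentiableAt.differentiableWithinAt

/-- **Montel's theorem** in several variables. -/
theorem exists_subseq_tendstoLocallyUniformlyOn {E : Type*} [NormedAddCommGroup E]
    [NormedSpace ℂ E] [ProperSpace E] [SecondCountableTopology E] {F : ℕ → E → ℂ} {U : Set E}
    (hU : IsOpen U) (hF : ∀ n, DifferentiableOn ℂ (F n) U)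
    (hb : ∀ x ∈ U, ∃ r > 0, ∃ M, ball x r ⊆ U ∧ ∀ n, ∀ y ∈ ball x r, ‖F n y‖ ≤ M) :
    ∃ (k : ℕ → ℕ) (g : E → ℂ), StrictMono k ∧ DifferentiableOn ℂ g U ∧
      TendstoLocallyUniformlyOn (fun n => F (k n)) g atTop U := by
  have hb' : ∀ x : U, ∃ r > 0, ∃ M, ball (x : E) r ⊆ U ∧ ∀ n, ∀ y ∈ ball (x : E) r, ‖F n y‖ ≤ M :=
    fun x => hb x x.2
  choose r hr M hsub hM using hb'
  have hlip : ∀ n (x : U), ∀ y ∈ ball (x : E) (r x),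
      dist (F n y) (F n x) ≤ 2 * M x / r x * dist y x := by
    intro n x y hy
    refine Complex.dist_le_div_mul_dist_of_mapsTo_ball ((hF n).mono (hsub x)) (fun z hz => ?_) hy
    rw [mem_closedBall, dist_eq_norm]
    refine (norm_sub_le _ _).trans ?_
    linarith [hM x n z hz, hM x n x (mem_ball_self (hr x))]
  have hloc : LocallyCompactSpace U := hU.locallyCompactSpace
  -- the compact family of all functions satisfying the bounds common to the sequence
  set P : Set (U → ℂ) := {f | (∀ x, f x ∈ closedBall (0 : ℂ) (M x)) ∧
    ∀ x y : U, (y : E) ∈ ball (x : E) (r x) → dist (f y) (f x) ≤ 2 * M x / r x * dist y x} with hP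
  have hPcont : ∀ f ∈ P, Continuous f := by
    intro f hf
    refine continuous_iff_continuousAt.2 fun x => ?_
    have h1 : Tendsto (fun y : U => 2 * M x / r x * dist y x) (𝓝 x) (𝓝 0) := by
      have : Continuous fun y : U => 2 * M x / r x * dist y x := by fun_prop
      simpa using this.tendsto x
    refine tendsto_iff_dist_tendsto_zero.2 (squeeze_zero' (Eventually.of_forall fun y =>
      dist_nonneg) ?_ h1)
    filter_upwards [ball_mem_nhds x (hr x)] with y hy using hf.2 x y hy
  have hPcomp : IsCompact P := by
    have h1 : IsCompact (univ.pi fun x : U => closedBall (0 : ℂ) (M x)) :=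
      isCompact_univ_pi fun x => isCompact_closedBall _ _
    refine h1.of_isClosed_subset ?_ fun f hf x _ => hf.1 x
    have h2 : P = (⋂ x : U, (fun f : U → ℂ => f x) ⁻¹' closedBall (0 : ℂ) (M x)) ∩
        ⋂ x : U, ⋂ y : U, ⋂ _ : (y : E) ∈ ball (x : E) (r x),
          {f : U → ℂ | dist (f y) (f x) ≤ 2 * M x / r x * dist y x} := by
      ext f
      simp only [hP, mem_inter_iff, mem_iInter, mem_preimage, mem_ofPred_eq]
    rw [h2]
    exact (isClosed_iInter fun x => isClosed_closedBall.preimage (continuous_apply x)).inter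
      (isClosed_iInter fun x => isClosed_iInter fun y => isClosed_iInter fun _ =>
        isClosed_le ((continuous_apply y).dist (continuous_apply x)) continuous_const)
  set S : Set C(U, ℂ) := {f | ⇑f ∈ P} with hS
  have hScomp : IsCompact S := by
    refine ArzelaAscoli.isCompact_of_equicontinuous S ?_ ?_
    · have : ContinuousMap.toFun '' S = P := by
        ext f
        constructor
        · rintro ⟨f, hf, rfl⟩; exact hf
        · intro hf; exact ⟨⟨f, hPcont f hf⟩, hf, rfl⟩
      rwa [this]
    · intro x
      rw [Metric.equicontinuousAt_iff_right]
      intro ε hε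
      have h1 : Tendsto (fun y : U => 2 * M x / r x * dist y x) (𝓝 x) (𝓝 0) := by
        have : Continuous fun y : U => 2 * M x / r x * dist y x := by fun_prop
        simpa using this.tendsto x
      filter_upwards [ball_mem_nhds x (hr x), h1.eventually_lt_const hε] with y hy hy2 f
      rw [dist_comm]
      exact (f.2.2 x y hy).trans_lt hy2
  have hmem : ∀ n, (⟨U.domRestrict (F n), continuousOn_iff_continuous_domRestrict.1
      (hF n).continuousOn⟩ : C(U, ℂ)) ∈ S := fun n =>
    ⟨fun x => mem_closedBall_zero_iff.2 (hM x n x (mem_ball_self (hr x))),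
      fun x y hy => hlip n x y hy⟩
  obtain ⟨g, -, k, hk, hlim⟩ := hScomp.tendsto_subseq hmem
  rw [ContinuousMap.tendsto_iff_tendstoLocallyUniformly] at hlim
  have hconv : TendstoLocallyUniformlyOn (fun n => F (k n)) (Function.extend Subtype.val g 0)
      atTop U := by
    rw [tendstoLocallyUniformlyOn_iff_tendstoLocallyUniformly_comp_coe]
    have : Function.extend Subtype.val g 0 ∘ (fun x : U => (x : E)) = g :=
      funext fun x => Subtype.val_injective.extend_apply _ _ x
    rw [this]
    exact hlim
  exact ⟨k, _, hk, differentiableOn_of_tendstoLocallyUniformlyOn hU (fun n => hF _) hconv, hconv⟩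

/-! ### Sufficiency: the weighted inequality implies compactness -/

/-- The squared `L²` norm over the bidisc of a function on `ℂ²`, as an extended nonnegative
number. -/
def bergmanEnergy (F : ℂ × ℂ → ℂ) : ℝ≥0∞ := ∫⁻ z in bidisc, ‖F z‖ₑ ^ 2

theorem lintegral_bidiscVolume (H : ℂ × ℂ → ℝ≥0∞) :
    ∫⁻ z : bidisc, H z ∂bidiscVolume = ∫⁻ z in bidisc, H z :=
  lintegral_subtype_comap measurableSet_bidisc H

theorem volume_bidisc_ne_top : volume bidisc ≠ ∞ :=
  (isBounded_ball.prod isBounded_ball).measure_lt_top.ne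

theorem mem_bergmanSubmodule_iff {f : bidisc → ℂ} {F : ℂ × ℂ → ℂ} (hF : DifferentiableOn ℂ F bidisc)
    (h : ∀ z : bidisc, f z = F z) : f ∈ bergmanSubmodule ↔ bergmanEnergy F < ∞ := by
  have hol : IsHolomorphic f := ⟨F, hF, h⟩
  have h1 : f ∈ bergmanSubmodule ↔ Integrable (fun z => ‖f z‖ ^ 2) bidiscVolume :=
    and_iff_right hol
  have h2 : AEStronglyMeasurable (fun z => ‖f z‖ ^ 2) bidiscVolume :=
    (hol.continuous.norm.pow 2).aestronglyMeasurable
  have h3 : ∫⁻ z, ‖‖f z‖ ^ 2‖ₑ ∂bidiscVolume = bergmanEnergy F := by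
    rw [bergmanEnergy, ← lintegral_bidiscVolume]
    refine lintegral_congr fun z => ?_
    rw [enorm_pow, enorm_norm, h]
  rw [h1, Integrable, and_iff_right h2, HasFiniteIntegral, h3]

theorem ofReal_norm_sq_eq_bergmanEnergy (f : BergmanSpace) {F : ℂ × ℂ → ℂ}
    (h : ∀ z : bidisc, f z = F z) : ENNReal.ofReal (‖f‖ ^ 2) = bergmanEnergy F := by
  rw [BergmanSpace.norm_sq_eq, ofReal_integral_eq_lintegral_ofReal f.toFun_mem.2
    (ae_of_all _ fun z => sq_nonneg _), bergmanEnergy, ← lintegral_bidiscVolume]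
  refine lintegral_congr fun z => ?_
  rw [ENNReal.ofReal_pow (norm_nonneg _), ofReal_norm, h]

theorem BergmanSpace.exists_extension (f : BergmanSpace) :
    ∃ F : ℂ × ℂ → ℂ, DifferentiableOn ℂ F bidisc ∧ ∀ z : bidisc, f z = F z := f.toFun_mem.1

theorem tendsto_zero_iff_bergmanEnergy {ι : Type*} {l : Filter ι} {h : ι → BergmanSpace}
    {H : ι → ℂ × ℂ → ℂ} (hH : ∀ i, ∀ z : bidisc, h i z = H i z) :
    Tendsto h l (𝓝 0) ↔ Tendsto (fun i => bergmanEnergy (H i)) l (𝓝 0) := by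
  simp only [← fun i => ofReal_norm_sq_eq_bergmanEnergy (h i) (hH i)]
  rw [tendsto_zero_iff_norm_tendsto_zero]
  constructor
  · intro h1
    have := ENNReal.tendsto_ofReal (h1.pow 2)
    simpa using this
  · intro h1
    have h2 := (ENNReal.tendsto_toReal ENNReal.zero_ne_top).comp h1
    have h3 : Tendsto (fun i => ‖h i‖ ^ 2) l (𝓝 0) := by
      simpa [Function.comp_def, ENNReal.toReal_ofReal] using h2
    have h4 := (Real.continuous_sqrt.tendsto 0).comp h3
    simpa [Function.comp_def] using h4

/-- The unit ball of the Bergman space is locally uniformly bounded, by the sub-mean value property. -/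
theorem exists_bound_of_bergmanEnergy_le_one {x : ℂ × ℂ} (hx : x ∈ bidisc) :
    ∃ r > 0, ∃ M : ℝ, ball x r ⊆ bidisc ∧ ∀ F : ℂ × ℂ → ℂ, DifferentiableOn ℂ F bidisc →
      bergmanEnergy F ≤ 1 → ∀ y ∈ ball x r, ‖F y‖ ≤ M := by
  obtain ⟨R, hR, hRU⟩ := Metric.isOpen_iff.1 isOpen_bidisc x hx
  set r := R / 2 with hr
  have hr0 : 0 < r := by positivity
  set v := volume (ball (0 : ℂ) r) * volume (ball (0 : ℂ) r) with hv
  have hv0 : v ≠ 0 := mul_ne_zero (measure_ball_pos _ _ hr0).ne' (measure_ball_pos _ _ hr0).ne'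
  refine ⟨r, hr0, v⁻¹.toReal + 1, (ball_subset_ball (by linarith)).trans hRU,
    fun F hF hE y hy => ?_⟩
  have hsub : ball y.1 r ×ˢ ball y.2 r ⊆ bidisc := by
    rw [ball_prod_same]
    refine subset_trans (fun z hz => ?_) hRU
    have := dist_triangle z y x
    rw [mem_ball] at hz hy ⊢
    rw [hr] at hz hy
    linarith
  have h1 := enorm_sq_mul_volume_polydisc_le hr0 (hF.mono hsub)
  rw [Complex.volume_ball, Complex.volume_ball, ← Complex.volume_ball 0 r, ← hv] at h1
  have h2 : ‖F y‖ₑ ^ 2 ≤ v⁻¹ := by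
    rw [ENNReal.le_inv_iff_mul_le]
    exact h1.trans ((lintegral_mono_set hsub).trans hE)
  have h3 := ENNReal.toReal_mono (ENNReal.inv_ne_top.2 hv0) h2
  rw [ENNReal.toReal_pow, toReal_enorm] at h3
  nlinarith [sq_nonneg (‖F y‖ - 1)]

/-- Locally uniform convergence and bounded energy give convergence of the energy with a weight
vanishing at the boundary. -/
theorem tendsto_weighted_energy_zero {D : ℕ → ℂ × ℂ → ℂ} {M : ℝ≥0∞} (hM : M ≠ ∞)
    (hE : ∀ n, bergmanEnergy (D n) ≤ M)
    (hD : ∀ K ⊆ bidisc, IsCompact K → TendstoUniformlyOn D 0 atTop K) :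
    Tendsto (fun n => ∫⁻ u in bidisc, ENNReal.ofReal (1 - ‖u‖) * ‖D n u‖ₑ ^ 2) atTop (𝓝 0) := by
  have key : ∀ ε : ℝ, 0 < ε → ∀ᶠ n in atTop,
      ∫⁻ u in bidisc, ENNReal.ofReal (1 - ‖u‖) * ‖D n u‖ₑ ^ 2 ≤
        ENNReal.ofReal ε * (M + volume bidisc) := by
    intro ε hε
    have hK : closedBall (0 : ℂ × ℂ) (1 - ε) ⊆ bidisc := by
      rw [bidisc, ball_prod_same]
      exact closedBall_subset_ball (by linarith)
    have h1 := hD _ hK (isCompact_closedBall _ _)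
    rw [Metric.tendstoUniformlyOn_iff] at h1
    filter_upwards [h1 (√ε) (Real.sqrt_pos.2 hε)] with n hn
    calc ∫⁻ u in bidisc, ENNReal.ofReal (1 - ‖u‖) * ‖D n u‖ₑ ^ 2 ≤
        ∫⁻ u in bidisc, (ENNReal.ofReal ε * ‖D n u‖ₑ ^ 2 + ENNReal.ofReal ε) := by
          refine lintegral_mono fun u => ?_
          rcases le_total ‖u‖ (1 - ε) with hu | hu
          · have h2 := hn u (mem_closedBall_zero_iff.2 hu)
            rw [Pi.zero_apply, dist_zero_left] at h2
            have h3 : ‖D n u‖ₑ ^ 2 ≤ ENNReal.ofReal ε := by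
              rw [← ofReal_norm, ← ENNReal.ofReal_pow (norm_nonneg _)]
              refine ENNReal.ofReal_le_ofReal ?_
              rw [← Real.sq_sqrt hε.le]
              exact pow_le_pow_left₀ (norm_nonneg _) h2.le 2
            have h4 : ENNReal.ofReal (1 - ‖u‖) ≤ 1 :=
              ENNReal.ofReal_le_one.2 (by linarith [norm_nonneg u])
            calc _ ≤ 1 * ENNReal.ofReal ε := mul_le_mul' h4 h3
              _ ≤ _ := by rw [one_mul]; exact le_add_self
          · refine le_trans (mul_le_mul' (ENNReal.ofReal_le_ofReal ?_) le_rfl) le_self_add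
            linarith
      _ = ENNReal.ofReal ε * bergmanEnergy (D n) + ENNReal.ofReal ε * volume bidisc := by
          rw [lintegral_add_right _ measurable_const, lintegral_const_mul' _ _ ENNReal.ofReal_ne_top,
            setLIntegral_const, bergmanEnergy]
      _ ≤ _ := by
          rw [mul_add]
          gcongr
          exact hE n
  rw [ENNReal.tendsto_nhds_zero]
  intro e he
  have h1 : Tendsto (fun ε : ℝ => ENNReal.ofReal ε * (M + volume bidisc)) (𝓝[>] 0) (𝓝 0) := by
    have h2 : Tendsto (fun ε : ℝ => ENNReal.ofReal ε) (𝓝[>] 0) (𝓝 0) := by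
      have := ENNReal.tendsto_ofReal (tendsto_id (α := ℝ) (x := 𝓝 0))
      simp only [id, ENNReal.ofReal_zero] at this
      exact this.mono_left nhdsWithin_le_nhds
    have := ENNReal.Tendsto.mul_const h2
      (Or.inr (ENNReal.add_ne_top.2 ⟨hM, volume_bidisc_ne_top⟩))
    rwa [zero_mul] at this
  obtain ⟨ε, hε, hε0⟩ := ((h1.eventually (Iic_mem_nhds he)).and self_mem_nhdsWithin).exists
  filter_upwards [key ε hε0] with n hn using hn.trans hε

/-- An estimate of `f ∘ φ` by `f` with a weight vanishing at the boundary makes the composition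
operator compact. -/
theorem isCompactOnBergman_of_lintegral_comp_le {φ : ℂ × ℂ → ℂ × ℂ}
    (hmaps : MapsTo φ bidisc bidisc) (hφ : DifferentiableOn ℂ φ bidisc) {A : ℝ}
    (hA : ∀ F : ℂ × ℂ → ℂ, DifferentiableOn ℂ F bidisc →
      ∫⁻ z in bidisc, ‖F (φ z)‖ₑ ^ 2 ≤
        ENNReal.ofReal A * ∫⁻ u in bidisc, ENNReal.ofReal (1 - ‖u‖) * ‖F u‖ₑ ^ 2) :
    IsCompactOnBergman (hmaps.restrict φ bidisc bidisc) := by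
  have hself : ∀ f ∈ bergmanSubmodule,
      compSymbol (hmaps.restrict φ bidisc bidisc) f ∈ bergmanSubmodule := by
    rintro f hf
    obtain ⟨F, hF, hfF⟩ := hf.1
    rw [mem_bergmanSubmodule_iff hF hfF] at hf
    rw [mem_bergmanSubmodule_iff (hF.comp hφ hmaps) (fun z => hfF _)]
    refine (hA F hF).trans_lt (ENNReal.mul_lt_top ENNReal.ofReal_lt_top (lt_of_le_of_lt ?_ hf))
    refine lintegral_mono fun u => mul_le_of_le_one_left' ?_
    exact ENNReal.ofReal_le_one.2 (by linarith [norm_nonneg u])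
  refine ⟨hself, compositionOperator _ hself '' closedBall 0 1, ?_, ?_⟩
  swap
  · exact mem_of_superset (closedBall_mem_nhds _ one_pos) (subset_preimage_image _ _)
  rw [isCompact_iff_isSeqCompact]
  intro x hx
  choose f hf hfx using hx
  choose F hF hfF using fun n => (f n).exists_extension
  have hE : ∀ n, bergmanEnergy (F n) ≤ 1 := fun n => by
    rw [← ofReal_norm_sq_eq_bergmanEnergy (f n) (hfF n), ENNReal.ofReal_le_one]
    exact pow_le_one₀ (norm_nonneg _) (mem_closedBall_zero_iff.1 (hf n))
  obtain ⟨k, G, hk, hG, hlim⟩ := exists_subseq_tendstoLocallyUniformlyOn isOpen_bidisc hF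
    fun x hx => by
      obtain ⟨r, hr, M, hs, hM⟩ := exists_bound_of_bergmanEnergy_le_one hx
      exact ⟨r, hr, M, hs, fun n => hM _ (hF n) (hE n)⟩
  have hGE : bergmanEnergy G ≤ 1 := by
    have hm : ∀ n, AEMeasurable (fun z => ‖F (k n) z‖ₑ ^ 2) (volume.restrict bidisc) := fun n =>
      ((hF _).continuousOn.aemeasurable measurableSet_bidisc).enorm.pow_const 2
    calc bergmanEnergy G = ∫⁻ z in bidisc, liminf (fun n => ‖F (k n) z‖ₑ ^ 2) atTop := by
          refine setLIntegral_congr_fun measurableSet_bidisc fun z hz => ?_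
          exact (((ENNReal.continuous_pow 2).tendsto _).comp (hlim.tendsto_at hz).enorm).liminf_eq.symm
      _ ≤ liminf (fun n => bergmanEnergy (F (k n))) atTop := lintegral_liminf_le' hm
      _ ≤ 1 := liminf_le_of_le (by isBoundedDefault) fun b hb => by
          obtain ⟨n, hn⟩ := hb.exists
          exact hn.trans (hE _)
  set g : BergmanSpace := BergmanSpace.ofFun (fun z => G z)
    ((mem_bergmanSubmodule_iff hG fun _ => rfl).2 (hGE.trans_lt ENNReal.one_lt_top)) with hg
  have hgG : ∀ z : bidisc, g z = G z := fun _ => rfl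
  have hg1 : ‖g‖ ≤ 1 := by
    have := ofReal_norm_sq_eq_bergmanEnergy g hgG
    rw [← this, ENNReal.ofReal_le_one] at hGE
    nlinarith [norm_nonneg g]
  refine ⟨_, ⟨g, mem_closedBall_zero_iff.2 hg1, rfl⟩, k, hk, ?_⟩
  have hd : ∀ n, ∀ z : bidisc, (f (k n) - g) z = (F (k n) - G) z := fun n z => by
    rw [Pi.sub_apply, ← hfF, ← hgG]; rfl
  have hEd : ∀ n, bergmanEnergy (F (k n) - G) ≤ ENNReal.ofReal 4 := fun n => by
    rw [← ofReal_norm_sq_eq_bergmanEnergy _ (hd n)]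
    refine ENNReal.ofReal_le_ofReal ?_
    have h1 : ‖f (k n) - g‖ ≤ 2 := (norm_sub_le _ _).trans
      (by linarith [mem_closedBall_zero_iff.1 (hf (k n))])
    nlinarith [norm_nonneg (f (k n) - g)]
  have hw := tendsto_weighted_energy_zero ENNReal.ofReal_ne_top
    hEd
    (fun K hK hKc => by
      have h1 := (tendstoLocallyUniformlyOn_iff_forall_isCompact isOpen_bidisc).1 hlim K hK hKc
      rw [Metric.tendstoUniformlyOn_iff] at h1 ⊢
      intro ε hε
      filter_upwards [h1 ε hε] with n hn x hx
      have := hn x hx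
      rwa [Pi.zero_apply, dist_zero_left, Pi.sub_apply, ← dist_eq_norm, dist_comm])
  have hfin : Tendsto (fun n => bergmanEnergy (fun z => (F (k n) - G) (φ z))) atTop (𝓝 0) := by
    refine tendsto_of_tendsto_of_tendsto_of_le_of_le tendsto_const_nhds
      (?_ : Tendsto (fun n => ENNReal.ofReal A * ∫⁻ u in bidisc, ENNReal.ofReal (1 - ‖u‖) *
        ‖(F (k n) - G) u‖ₑ ^ 2) atTop (𝓝 0)) (fun _ => bot_le)
      (fun n => hA _ ((hF _).sub hG))
    have := ENNReal.Tendsto.const_mul hw (Or.inr (ENNReal.ofReal_ne_top (r := A)))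
    rwa [mul_zero] at this
  have h0 := (tendsto_zero_iff_bergmanEnergy
    (h := fun n => compositionOperator _ hself (f (k n) - g))
    (H := fun n z => (F (k n) - G) (φ z)) (fun n z => hd n (hmaps.restrict φ bidisc bidisc z))).2 hfin
  simp only [map_sub] at h0
  have h1 := tendsto_sub_nhds_zero_iff.1 h0
  exact h1.congr fun n => hfx (k n)

/-! ### Test functions and the obstruction to compactness -/

/-- Under a compact composition operator, a bounded sequence of functions tending to zero pointwise
has images whose norms are not bounded below. -/
theorem not_isCompactOnBergman_of_le_bergmanEnergy {φ : ℂ × ℂ → ℂ × ℂ}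
    (hmaps : MapsTo φ bidisc bidisc) {F : ℕ → ℂ × ℂ → ℂ}
    (hF : ∀ n, DifferentiableOn ℂ (F n) bidisc) {M : ℝ} (hM : ∀ n, bergmanEnergy (F n) ≤
      ENNReal.ofReal M) (hF0 : ∀ z ∈ bidisc, Tendsto (fun n => F n z) atTop (𝓝 0))
    {c : ℝ≥0∞} (hc : 0 < c) (hcF : ∀ n, c ≤ bergmanEnergy (fun z => F n (φ z))) :
    ¬ IsCompactOnBergman (hmaps.restrict φ bidisc bidisc) := by
  rintro ⟨hself, hcomp⟩
  set f : ℕ → BergmanSpace := fun n => BergmanSpace.ofFun (fun z => F n z)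
    ((mem_bergmanSubmodule_iff (hF n) fun _ => rfl).2 ((hM n).trans_lt ENNReal.ofReal_lt_top))
    with hf
  have hfF : ∀ n, ∀ z : bidisc, f n z = F n z := fun _ _ => rfl
  have hbound : ∀ n, f n ∈ closedBall (0 : BergmanSpace) (max M 0 + 1) := fun n => by
    have h1 := hM n
    rw [← ofReal_norm_sq_eq_bergmanEnergy (f n) (hfF n)] at h1
    have h2 : ‖f n‖ ^ 2 ≤ max M 0 := by
      rcases le_total 0 M with hM0 | hM0
      · exact ((ENNReal.ofReal_le_ofReal_iff hM0).1 h1).trans (le_max_left _ _)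
      · rw [ENNReal.ofReal_of_nonpos hM0, nonpos_iff_eq_zero, ENNReal.ofReal_eq_zero] at h1
        exact h1.trans (le_max_right _ _)
    rw [mem_closedBall_zero_iff]
    nlinarith [sq_nonneg (‖f n‖ - 1)]
  obtain ⟨K, hK, hsub⟩ := hcomp.image_closedBall_subset_compact (max M 0 + 1)
  obtain ⟨g, -, k, hk, hlim⟩ := hK.tendsto_subseq
    (x := fun n => compositionOperator _ hself (f n)) fun n => hsub (mem_image_of_mem _ (hbound n))
  obtain ⟨G, hG, hgG⟩ := g.exists_extension
  have hd : ∀ n, ∀ z : bidisc, (compositionOperator _ hself (f (k n)) - g) z =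
      (fun z => F (k n) (φ z) - G z) z := fun n z => by
    simp only [← hgG]; rfl
  have h1 := (tendsto_zero_iff_bergmanEnergy
    (h := fun n => compositionOperator _ hself (f (k n)) - g)
    (H := fun n z => F (k n) (φ z) - G z) hd).1 (tendsto_sub_nhds_zero_iff.2 hlim)
  have hF0' : ∀ z ∈ bidisc, Tendsto (fun n => F (k n) (φ z)) atTop (𝓝 0) := fun z hz =>
    (hF0 _ (hmaps hz)).comp hk.tendsto_atTop
  -- the limit vanishes by Fatou's lemma
  have hg : g = 0 := by
    have hm : ∀ n, AEMeasurable (fun z => ‖F (k n) (φ z) - G z‖ₑ ^ 2) (volume.restrict bidisc) := by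
      intro n
      obtain ⟨H, hH, hgH⟩ := (compositionOperator _ hself (f (k n)) - g).exists_extension
      refine (((hH.continuousOn.aemeasurable measurableSet_bidisc)).enorm.pow_const 2).congr ?_
      refine (ae_restrict_iff' measurableSet_bidisc).2 (ae_of_all _ fun z hz => ?_)
      simp only
      rw [← hgH ⟨z, hz⟩, hd n ⟨z, hz⟩]
    have h2 : bergmanEnergy G ≤ 0 := by
      calc bergmanEnergy G =
          ∫⁻ z in bidisc, liminf (fun n => ‖F (k n) (φ z) - G z‖ₑ ^ 2) atTop := by
            refine setLIntegral_congr_fun measurableSet_bidisc fun z hz => ?_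
            have h3 := (((ENNReal.continuous_pow 2).tendsto _).comp
              ((hF0' z hz).sub_const (G z)).enorm).liminf_eq
            rw [zero_sub, enorm_neg] at h3
            exact h3.symm
        _ ≤ liminf (fun n => bergmanEnergy (fun z => F (k n) (φ z) - G z)) atTop :=
            lintegral_liminf_le' hm
        _ = 0 := h1.liminf_eq
    rw [← ofReal_norm_sq_eq_bergmanEnergy g hgG, nonpos_iff_eq_zero, ENNReal.ofReal_eq_zero] at h2
    exact norm_eq_zero.1 (pow_eq_zero_iff two_ne_zero |>.1 (le_antisymm h2 (sq_nonneg _)))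
  rw [hg] at hlim
  have h2 := (tendsto_zero_iff_bergmanEnergy (H := fun n z => F (k n) (φ z)) fun n z => rfl).1 hlim
  exact absurd (ge_of_tendsto' h2 fun n => hcF (k n)) (not_le.2 hc)

/-- A multiple of the normalized reproducing kernel of the disc at the point `(1 - δ) η`. -/
def diskTest (η : ℂ) (δ : ℝ) (u : ℂ) : ℂ := δ / (1 - (1 - δ : ℝ) * conj η * u) ^ 2

section diskTest

variable {η : ℂ} {δ : ℝ}

theorem le_norm_diskTest_denom (hη : ‖η‖ = 1) (hδ1 : δ ≤ 1) (u : ℂ) :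
    1 - (1 - δ) * ‖u‖ ≤ ‖1 - (1 - δ : ℝ) * conj η * u‖ := by
  have := norm_sub_norm_le 1 ((1 - δ : ℝ) * conj η * u)
  rwa [norm_one, norm_mul, norm_mul, RCLike.norm_conj, hη, mul_one, Complex.norm_real,
    Real.norm_of_nonneg (by linarith)] at this

theorem diskTest_denom_ne_zero (hη : ‖η‖ = 1) (hδ0 : 0 < δ) (hδ1 : δ ≤ 1) {u : ℂ} (hu : ‖u‖ < 1) :
    1 - (1 - δ : ℝ) * conj η * u ≠ 0 := by
  rw [← norm_pos_iff]
  refine lt_of_lt_of_le ?_ (le_norm_diskTest_denom hη hδ1 u)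
  nlinarith [norm_nonneg u]

theorem differentiableOn_diskTest (hη : ‖η‖ = 1) (hδ0 : 0 < δ) (hδ1 : δ ≤ 1) :
    DifferentiableOn ℂ (diskTest η δ) (ball 0 1) := by
  refine DifferentiableOn.div (by fun_prop) (by fun_prop) fun u hu => pow_ne_zero 2 ?_
  exact diskTest_denom_ne_zero hη hδ0 hδ1 (by simpa using hu)

theorem norm_diskTest_le (hη : ‖η‖ = 1) (hδ0 : 0 < δ) (hδ1 : δ ≤ 1) {u : ℂ} (hu : ‖u‖ < 1) :
    ‖diskTest η δ u‖ ≤ δ / (1 - ‖u‖) ^ 2 := by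
  have h1 := le_norm_diskTest_denom hη hδ1 u
  have h2 : 0 < 1 - ‖u‖ := by linarith
  rw [diskTest, norm_div, norm_pow, Complex.norm_real, Real.norm_of_nonneg hδ0.le]
  gcongr
  nlinarith [norm_nonneg u]

theorem le_norm_diskTest (hη : ‖η‖ = 1) (hδ0 : 0 < δ) (hδ1 : δ ≤ 1) {u : ℂ} (hu : ‖u‖ < 1) {K : ℝ}
    (hK : ‖u - η‖ ≤ K * δ) : 1 / ((K + 1) ^ 2 * δ) ≤ ‖diskTest η δ u‖ := by
  have h0 : 0 < ‖1 - (1 - δ : ℝ) * conj η * u‖ :=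
    norm_pos_iff.2 (diskTest_denom_ne_zero hη hδ0 hδ1 hu)
  have h1 : ‖1 - (1 - δ : ℝ) * conj η * u‖ ≤ (K + 1) * δ := by
    have e : 1 - (1 - δ : ℝ) * conj η * u = conj η * (η - u) + δ * conj η * u := by
      rw [mul_sub, Complex.conj_mul', hη]
      push_cast
      ring
    rw [e]
    refine (norm_add_le _ _).trans ?_
    rw [norm_mul, norm_mul, norm_mul, RCLike.norm_conj, hη, Complex.norm_real,
      Real.norm_of_nonneg hδ0.le, norm_sub_rev]
    nlinarith
  rw [diskTest, norm_div, norm_pow, Complex.norm_real, Real.norm_of_nonneg hδ0.le]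
  have h2 : ‖1 - (1 - δ : ℝ) * conj η * u‖ ^ 2 ≤ ((K + 1) * δ) ^ 2 :=
    pow_le_pow_left₀ h0.le h1 2
  have h3 : 0 < K + 1 := by
    by_contra h
    nlinarith
  calc 1 / ((K + 1) ^ 2 * δ) = δ / ((K + 1) * δ) ^ 2 := by field_simp
    _ ≤ _ := by gcongr

/-- The test functions are bounded in `L²`: up to a bounded factor, `|diskTest η δ|²` is the
Jacobian of `δ / (1 - (1 - δ) conj η u)`, which maps the disc injectively into the unit disc. -/
theorem lintegral_diskTest_le (hη : ‖η‖ = 1) (hδ0 : 0 < δ) (hδ1 : δ ≤ 1 / 2) :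
    ∫⁻ u in ball 0 1, ‖diskTest η δ u‖ₑ ^ 2 ≤ ENNReal.ofReal (4 * π) := by
  set a : ℂ := (1 - δ : ℝ) * conj η with ha
  have hδ1' : δ ≤ 1 := by linarith
  have hna : ‖a‖ = 1 - δ := by
    rw [ha, norm_mul, RCLike.norm_conj, hη, mul_one, Complex.norm_real,
      Real.norm_of_nonneg (by linarith)]
  have ha0 : a ≠ 0 := by rw [← norm_pos_iff, hna]; linarith
  have hden : ∀ u ∈ ball (0 : ℂ) 1, 1 - a * u ≠ 0 := fun u hu =>
    diskTest_denom_ne_zero hη hδ0 hδ1' (by simpa using hu)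
  set ψ : ℂ → ℂ := fun u => δ / (1 - a * u) with hψ
  have hderiv : ∀ u ∈ ball (0 : ℂ) 1, HasDerivAt ψ (a * diskTest η δ u) u := by
    intro u hu
    have h1 : HasDerivAt (fun u : ℂ => 1 - a * u) (-a) u := by
      simpa using ((hasDerivAt_id u).const_mul a).const_sub 1
    have h2 := (hasDerivAt_const u (δ : ℂ)).div h1 (hden u hu)
    have e : a * diskTest η δ u = (0 * (1 - a * u) - δ * -a) / (1 - a * u) ^ 2 := by
      unfold diskTest
      rw [← ha]
      ring
    rw [e]
    exact h2
  have hinj : InjOn ψ (ball 0 1) := by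
    intro u hu v hv h
    have hδ' : (δ : ℂ) ≠ 0 := by exact_mod_cast hδ0.ne'
    simp only [hψ] at h
    rw [div_eq_div_iff (hden u hu) (hden v hv)] at h
    have h1 := mul_left_cancel₀ hδ' h
    exact mul_left_cancel₀ ha0 (by linear_combination h1)
  have himg : ψ '' ball 0 1 ⊆ closedBall 0 1 := by
    rintro _ ⟨u, hu, rfl⟩
    have hu' : ‖u‖ < 1 := by simpa using hu
    have h1 := le_norm_diskTest_denom hη hδ1' u
    rw [← ha] at h1
    rw [mem_closedBall_zero_iff, norm_div, Complex.norm_real, Real.norm_of_nonneg hδ0.le,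
      div_le_one (norm_pos_iff.2 (hden u hu))]
    nlinarith [norm_nonneg u]
  have hcv := lintegral_image_eq_lintegral_abs_det_fderiv_mul (f := ψ) volume measurableSet_ball
    (fun u hu => ((hderiv u hu).hasFDerivAt.restrictScalars ℝ).hasFDerivWithinAt) hinj
    (fun _ => 1)
  have hdet : ∀ d : ℂ, |((ContinuousLinearMap.toSpanSingleton ℂ d).restrictScalars ℝ).det| =
      ‖d‖ ^ 2 := by
    intro d
    simp [ContinuousLinearMap.det, LinearMap.det_restrictScalars,
      Algebra.norm_complex_eq, Complex.normSq_eq_norm_sq]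
  simp only [hdet, mul_one, setLIntegral_one] at hcv
  have h1 : ∀ u, ‖diskTest η δ u‖ₑ ^ 2 ≤
      ENNReal.ofReal 4 * ENNReal.ofReal (‖a * diskTest η δ u‖ ^ 2) := by
    intro u
    rw [← ofReal_norm, ← ENNReal.ofReal_pow (norm_nonneg _), ← ENNReal.ofReal_mul (by norm_num)]
    refine ENNReal.ofReal_le_ofReal ?_
    rw [norm_mul, hna, mul_pow]
    have : 1 ≤ 4 * (1 - δ) ^ 2 := by nlinarith
    nlinarith [sq_nonneg ‖diskTest η δ u‖]
  calc _ ≤ ∫⁻ u in ball 0 1, ENNReal.ofReal 4 * ENNReal.ofReal (‖a * diskTest η δ u‖ ^ 2) :=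
        lintegral_mono h1
    _ = ENNReal.ofReal 4 * volume (ψ '' ball 0 1) := by
        rw [lintegral_const_mul' _ _ ENNReal.ofReal_ne_top, hcv]
    _ ≤ ENNReal.ofReal 4 * volume (closedBall (0 : ℂ) 1) := by gcongr
    _ = _ := by
        rw [Complex.volume_closedBall, ENNReal.ofReal_mul (by norm_num)]
        simp [← NNReal.coe_real_pi]

end diskTest

/-! ### Sets on which the symbol is close to a boundary value -/

theorem bergmanEnergy_mul {f g : ℂ → ℂ} (hf : DifferentiableOn ℂ f (ball 0 1))
    (hg : DifferentiableOn ℂ g (ball 0 1)) :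
    bergmanEnergy (fun z => f z.1 * g z.2) =
      (∫⁻ u in ball 0 1, ‖f u‖ₑ ^ 2) * ∫⁻ u in ball 0 1, ‖g u‖ₑ ^ 2 := by
  rw [bergmanEnergy, bidisc, Measure.volume_eq_prod, ← Measure.prod_restrict]
  simp only [enorm_mul, mul_pow]
  exact lintegral_prod_mul ((hf.continuousOn.aemeasurable measurableSet_ball).enorm.pow_const 2)
    ((hg.continuousOn.aemeasurable measurableSet_ball).enorm.pow_const 2)

/-- Product test functions which are large after composition with `φ`, on sets that are not too
small, obstruct compactness. -/
theorem not_isCompactOnBergman_of_le_on {φ : ℂ × ℂ → ℂ × ℂ}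
    (hmaps : MapsTo φ bidisc bidisc) {f g : ℕ → ℂ → ℂ}
    (hf : ∀ n, DifferentiableOn ℂ (f n) (ball 0 1)) (hg : ∀ n, DifferentiableOn ℂ (g n) (ball 0 1))
    (hfM : ∀ n, ∫⁻ u in ball 0 1, ‖f n u‖ₑ ^ 2 ≤ ENNReal.ofReal (4 * π))
    (hgM : ∀ n, ∫⁻ u in ball 0 1, ‖g n u‖ₑ ^ 2 ≤ ENNReal.ofReal (4 * π))
    (h0 : ∀ z ∈ bidisc, Tendsto (fun n => f n z.1 * g n z.2) atTop (𝓝 0))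
    {S : ℕ → Set (ℂ × ℂ)} (hSm : ∀ n, MeasurableSet (S n)) (hSb : ∀ n, S n ⊆ bidisc)
    {a v : ℕ → ℝ} {c : ℝ} (hc : 0 < c) (ha : ∀ n, 0 ≤ a n)
    (haS : ∀ n, ∀ z ∈ S n, a n ≤ ‖f n (φ z).1 * g n (φ z).2‖)
    (hv : ∀ n, ENNReal.ofReal (v n) ≤ volume (S n)) (hav : ∀ n, c ≤ a n ^ 2 * v n) :
    ¬ IsCompactOnBergman (hmaps.restrict φ bidisc bidisc) := by
  refine not_isCompactOnBergman_of_le_bergmanEnergy hmaps (F := fun n z => f n z.1 * g n z.2)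
    (M := 4 * π * (4 * π)) (c := ENNReal.ofReal c) (fun n => ?_) (fun n => ?_) h0
    (ENNReal.ofReal_pos.2 hc) (fun n => ?_)
  · exact ((hf n).comp differentiableOn_fst fun z hz => hz.1).mul
      ((hg n).comp differentiableOn_snd fun z hz => hz.2)
  · rw [bergmanEnergy_mul (hf n) (hg n), ENNReal.ofReal_mul (by positivity)]
    exact mul_le_mul' (hfM n) (hgM n)
  · calc ENNReal.ofReal c ≤ ENNReal.ofReal (a n ^ 2) * ENNReal.ofReal (v n) := by
          rw [← ENNReal.ofReal_mul (sq_nonneg _)]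
          exact ENNReal.ofReal_le_ofReal (hav n)
      _ ≤ ENNReal.ofReal (a n ^ 2) * volume (S n) := by gcongr; exact hv n
      _ = ∫⁻ z in S n, ENNReal.ofReal (a n ^ 2) := (setLIntegral_const _ _).symm
      _ ≤ ∫⁻ z in S n, ‖f n (φ z).1 * g n (φ z).2‖ₑ ^ 2 := by
          refine setLIntegral_mono' (hSm n) fun z hz => ?_
          rw [← ofReal_norm, ← ENNReal.ofReal_pow (norm_nonneg _)]
          exact ENNReal.ofReal_le_ofReal (pow_le_pow_left₀ (ha n) (haS n z hz) 2)
      _ ≤ _ := lintegral_mono_set (hSb n)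

/-- The unit disc contains a fixed proportion of every small disc centred at a point of its
closure. -/
theorem exists_ball_subset_inter {p : ℂ} (hp : ‖p‖ ≤ 1) {δ : ℝ} (hδ0 : 0 < δ) (hδ1 : δ ≤ 1) :
    ∃ q : ℂ, ball q (δ / 2) ⊆ ball 0 1 ∩ closedBall p δ ∧
      ENNReal.ofReal (δ ^ 2 / 4) ≤ volume (ball q (δ / 2)) := by
  refine ⟨(1 - δ / 2 : ℝ) * p, fun z hz => ?_, ?_⟩
  · have h1 : ‖((1 - δ / 2 : ℝ) : ℂ) * p‖ ≤ 1 - δ / 2 := by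
      rw [norm_mul, Complex.norm_real, Real.norm_of_nonneg (by linarith)]
      exact mul_le_of_le_one_right (by linarith) hp
    have h2 : dist (((1 - δ / 2 : ℝ) : ℂ) * p) p ≤ δ / 2 := by
      have e : ((1 - δ / 2 : ℝ) : ℂ) * p - p = -((δ / 2 : ℝ) * p) := by push_cast; ring
      rw [dist_eq_norm, e, norm_neg, norm_mul, Complex.norm_real,
        Real.norm_of_nonneg (by linarith)]
      exact mul_le_of_le_one_right (by linarith) hp
    rw [mem_ball] at hz
    constructor
    · have h3 := dist_triangle z (((1 - δ / 2 : ℝ) : ℂ) * p) 0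
      rw [dist_zero_right (((1 - δ / 2 : ℝ) : ℂ) * p)] at h3
      rw [mem_ball]
      linarith
    · have h3 := dist_triangle z (((1 - δ / 2 : ℝ) : ℂ) * p) p
      rw [mem_closedBall]
      linarith
  · rw [Complex.volume_ball, ← ENNReal.ofReal_pow (by linarith), ← ENNReal.ofReal_coe_nnreal,
      NNReal.coe_real_pi, ← ENNReal.ofReal_mul (by positivity)]
    refine ENNReal.ofReal_le_ofReal ?_
    nlinarith [Real.pi_gt_three, sq_nonneg δ]

theorem closure_bidisc : closure bidisc = closedBall 0 1 ×ˢ closedBall 0 1 := by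
  rw [bidisc, closure_prod_eq, closure_ball _ one_ne_zero]

theorem mem_closure_bidisc_iff {z : ℂ × ℂ} : z ∈ closure bidisc ↔ ‖z.1‖ ≤ 1 ∧ ‖z.2‖ ≤ 1 := by
  simp [closure_bidisc, mem_prod]

/-- If a Lipschitz function, holomorphic and bounded by `1` on the bidisc, attains modulus `1` at
`(p₁, p₂)` with `|p₂| < 1`, then it is constant on the disc `{p₁} × 𝔻`. -/
theorem eq_of_norm_eq_one {g : ℂ × ℂ → ℂ} {K : ℝ≥0} (hg : DifferentiableOn ℂ g bidisc)
    (hLip : LipschitzOnWith K g (closure bidisc)) (hb : ∀ z ∈ closure bidisc, ‖g z‖ ≤ 1)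
    {p : ℂ × ℂ} (hp1 : ‖p.1‖ ≤ 1) (hp2 : ‖p.2‖ < 1) (hgp : ‖g p‖ = 1) {y : ℂ} (hy : ‖y‖ < 1) :
    g (p.1, y) = g p := by
  have hs : ∀ n : ℕ, 0 ≤ 1 - 1 / ((n : ℝ) + 1) ∧ 1 - 1 / ((n : ℝ) + 1) < 1 := fun n => by
    have h1 : 0 < 1 / ((n : ℝ) + 1) := by positivity
    have h2 : 1 / ((n : ℝ) + 1) ≤ 1 := by
      rw [div_le_one (by positivity)]
      linarith [(Nat.cast_nonneg n : (0 : ℝ) ≤ n)]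
    exact ⟨by linarith, by linarith⟩
  set x : ℕ → ℂ := fun n => (1 - 1 / ((n : ℝ) + 1) : ℝ) * p.1 with hx
  have hxn : ∀ n, ‖x n‖ < 1 := fun n => by
    rw [hx]
    simp only
    rw [norm_mul, Complex.norm_real, Real.norm_of_nonneg (hs n).1]
    nlinarith [hs n, norm_nonneg p.1]
  have hxd : ∀ n, dist p.1 (x n) ≤ 1 / ((n : ℝ) + 1) := fun n => by
    have e : p.1 - x n = (1 / ((n : ℝ) + 1) : ℝ) * p.1 := by
      simp only [hx]; push_cast; ring
    rw [dist_eq_norm, e, norm_mul, Complex.norm_real, Real.norm_of_nonneg (by positivity)]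
    exact mul_le_of_le_one_right (by positivity) hp1
  -- `p.1` may lie on the circle, so the slice is a uniform limit of slices inside the bidisc
  have hdiff : DifferentiableOn ℂ (fun y => g (p.1, y)) (ball 0 1) := by
    refine differentiableOn_of_tendstoLocallyUniformlyOn (F := fun n y => g (x n, y)) isOpen_ball
      (fun n => hg.comp (by fun_prop) fun y hy => mem_bidisc_iff.2 ⟨hxn n, by simpa using hy⟩) ?_
    refine TendstoUniformlyOn.tendstoLocallyUniformlyOn ?_
    rw [Metric.tendstoUniformlyOn_iff]
    intro ε hε
    have h1 : Tendsto (fun n : ℕ => (K : ℝ) * (1 / ((n : ℝ) + 1))) atTop (𝓝 0) := by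
      simpa using tendsto_one_div_add_atTop_nhds_zero_nat.const_mul (K : ℝ)
    filter_upwards [h1.eventually_lt_const hε] with n hn y hy
    have hy' : ‖y‖ ≤ 1 := by
      have := mem_ball_zero_iff.1 hy
      exact this.le
    refine lt_of_le_of_lt (hLip.dist_le_mul (p.1, y) (mem_closure_bidisc_iff.2 ⟨hp1, hy'⟩)
      (x n, y) (mem_closure_bidisc_iff.2 ⟨(hxn n).le, hy'⟩)) (lt_of_le_of_lt ?_ hn)
    rw [Prod.dist_eq]
    simp only [dist_self, dist_nonneg, sup_of_le_left]
    gcongr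
    exact hxd n
  -- the slice function is bounded by `1` and attains modulus `1` at the interior point `p.2`
  have hmax : IsMaxOn (norm ∘ fun y => g (p.1, y)) (ball 0 1) p.2 := fun y hy => by
    simp only [Function.comp_apply, mem_ofPred_eq]
    rw [show g (p.1, p.2) = g p from rfl, hgp]
    exact hb _ (mem_closure_bidisc_iff.2 ⟨hp1, (mem_ball_zero_iff.1 hy).le⟩)
  exact Complex.eqOn_of_isPreconnected_of_isMaxOn_norm (convex_ball (0 : ℂ) 1).isPreconnected
    isOpen_ball hdiff (mem_ball_zero_iff.2 hp2) hmax (mem_ball_zero_iff.2 hy)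

theorem exists_set_near_value_of_snd_lt {g : ℂ × ℂ → ℂ} {K : ℝ≥0} (hg : DifferentiableOn ℂ g bidisc)
    (hLip : LipschitzOnWith K g (closure bidisc)) (hb : ∀ z ∈ closure bidisc, ‖g z‖ ≤ 1)
    {p : ℂ × ℂ} (hp1 : ‖p.1‖ ≤ 1) (hp2 : ‖p.2‖ < 1) (hgp : ‖g p‖ = 1) {δ : ℝ} (hδ0 : 0 < δ)
    (hδ1 : δ ≤ 1) :
    ∃ S ⊆ bidisc, MeasurableSet S ∧ ENNReal.ofReal (δ ^ 2 / 4) ≤ volume S ∧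
      ∀ z ∈ S, ‖g z - g p‖ ≤ K * δ := by
  obtain ⟨q, hq, hqv⟩ := exists_ball_subset_inter hp1 hδ0 hδ1
  refine ⟨ball q (δ / 2) ×ˢ ball 0 1, fun z hz => ⟨(hq hz.1).1, hz.2⟩,
    measurableSet_ball.prod measurableSet_ball, ?_, fun z hz => ?_⟩
  · rw [Measure.volume_eq_prod, Measure.prod_prod]
    refine hqv.trans (le_mul_of_one_le_right' ?_)
    rw [Complex.volume_ball, ← ENNReal.ofReal_coe_nnreal, NNReal.coe_real_pi]
    simp only [ENNReal.ofReal_one, one_pow, one_mul, ENNReal.one_le_ofReal]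
    linarith [Real.pi_gt_three]
  · have hz1 := hq hz.1
    have hz2 : ‖z.2‖ < 1 := mem_ball_zero_iff.1 hz.2
    rw [← eq_of_norm_eq_one hg hLip hb hp1 hp2 hgp hz2, ← dist_eq_norm]
    refine (hLip.dist_le_mul z (mem_closure_bidisc_iff.2 ⟨(mem_ball_zero_iff.1 hz1.1).le, hz2.le⟩)
      (p.1, z.2) (mem_closure_bidisc_iff.2 ⟨hp1, hz2.le⟩)).trans ?_
    rw [Prod.dist_eq]
    simp only [dist_self, dist_nonneg, sup_of_le_left]
    gcongr
    exact hz1.2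

/-- A Lipschitz function, holomorphic and bounded by `1` on the bidisc, which attains modulus `1`
off the distinguished boundary is within `K δ` of that value on a set of volume at least a constant
times `δ²`. -/
theorem exists_set_near_value {g : ℂ × ℂ → ℂ} {K : ℝ≥0} (hg : DifferentiableOn ℂ g bidisc)
    (hLip : LipschitzOnWith K g (closure bidisc)) (hb : ∀ z ∈ closure bidisc, ‖g z‖ ≤ 1)
    {p : ℂ × ℂ} (hp : p ∈ closure bidisc \ torus2) (hgp : ‖g p‖ = 1) {δ : ℝ} (hδ0 : 0 < δ)
    (hδ1 : δ ≤ 1) :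
    ∃ S ⊆ bidisc, MeasurableSet S ∧ ENNReal.ofReal (δ ^ 2 / 4) ≤ volume S ∧
      ∀ z ∈ S, ‖g z - g p‖ ≤ K * δ := by
  obtain ⟨hp1, hp2⟩ := mem_closure_bidisc_iff.1 hp.1
  by_cases h2 : ‖p.2‖ < 1
  · exact exists_set_near_value_of_snd_lt hg hLip hb hp1 h2 hgp hδ0 hδ1
  have h1 : ‖p.1‖ < 1 := by
    by_contra h1
    exact hp.2 ⟨mem_sphere_zero_iff_norm.2 (le_antisymm hp1 (not_lt.1 h1)),
      mem_sphere_zero_iff_norm.2 (le_antisymm hp2 (not_lt.1 h2))⟩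
  have hsw : MapsTo Prod.swap bidisc bidisc := fun z hz => ⟨hz.2, hz.1⟩
  have hswc : MapsTo Prod.swap (closure bidisc) (closure bidisc) := hsw.closure continuous_swap
  have hLs : LipschitzWith 1 (Prod.swap : ℂ × ℂ → ℂ × ℂ) :=
    LipschitzWith.of_dist_le_mul fun z w => by
      simp [Prod.dist_eq, max_comm]
  obtain ⟨S, hS, hSm, hSv, hSg⟩ := exists_set_near_value_of_snd_lt (g := g ∘ Prod.swap) (K := K)
    (p := p.swap) (hg.comp (differentiableOn_snd.prodMk differentiableOn_fst) hsw)
    (by simpa using hLip.comp (hLs.lipschitzOnWith (s := closure bidisc)) hswc)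
    (fun z hz => hb _ (hswc hz)) hp2 h1 (by simpa using hgp) hδ0 hδ1
  refine ⟨Prod.swap ⁻¹' S, fun z hz => by simpa using hsw (hS hz), measurable_swap hSm, ?_,
    fun z hz => by simpa using hSg _ hz⟩
  rw [Measure.volume_eq_prod, Measure.measurePreserving_swap.measure_preimage
    hSm.nullMeasurableSet]
  exact hSv

/-! ### The two directions -/

/-- The scales `1 / (n + 2)` at which the test functions are taken. -/
def testScale (n : ℕ) : ℝ := 1 / ((n : ℝ) + 2)

theorem testScale_pos (n : ℕ) : 0 < testScale n := by unfold testScale; positivity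

theorem testScale_le_half (n : ℕ) : testScale n ≤ 1 / 2 := by
  unfold testScale
  exact one_div_le_one_div_of_le two_pos (by linarith [(Nat.cast_nonneg n : (0 : ℝ) ≤ n)])

theorem testScale_le_one (n : ℕ) : testScale n ≤ 1 := by linarith [testScale_le_half n]

theorem tendsto_testScale : Tendsto testScale atTop (𝓝 0) := by
  have h := (tendsto_one_div_add_atTop_nhds_zero_nat (𝕜 := ℝ)).comp (tendsto_add_atTop_nat 1)
  refine h.congr fun n => ?_
  simp only [Function.comp_apply, testScale]
  push_cast
  ring

theorem tendsto_diskTest {η : ℂ} (hη : ‖η‖ = 1) {u : ℂ} (hu : ‖u‖ < 1) :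
    Tendsto (fun n => diskTest η (testScale n) u) atTop (𝓝 0) := by
  refine squeeze_zero_norm
    (fun n => norm_diskTest_le hη (testScale_pos n) (testScale_le_one n) hu) ?_
  simpa using tendsto_testScale.div_const ((1 - ‖u‖) ^ 2)

theorem lintegral_enorm_one_le : ∫⁻ _ in ball (0 : ℂ) 1, ‖(1 : ℂ)‖ₑ ^ 2 ≤ ENNReal.ofReal (4 * π) := by
  rw [setLIntegral_const, Complex.volume_ball, ← ENNReal.ofReal_coe_nnreal, NNReal.coe_real_pi]
  simp only [enorm_one, one_pow, one_mul, ENNReal.ofReal_one]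
  exact ENNReal.ofReal_le_ofReal (by linarith [Real.pi_pos])

variable {φ : ℂ × ℂ → ℂ × ℂ}

/-- If a coordinate of `φ` has modulus `1` off the distinguished boundary, then the composition
operator is not compact. -/
theorem not_isCompactOnBergman_of_norm_eq_one (hmaps : MapsTo φ bidisc bidisc)
    (hφ : DifferentiableOn ℂ φ bidisc) {K₁ K₂ : ℝ≥0}
    (h₁ : LipschitzOnWith K₁ (fun z => (φ z).1) (closure bidisc))
    (h₂ : LipschitzOnWith K₂ (fun z => (φ z).2) (closure bidisc))
    (hcl : MapsTo φ (closure bidisc) (closure bidisc)) {p : ℂ × ℂ}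
    (hp : p ∈ closure bidisc \ torus2) (hφp : ‖(φ p).1‖ = 1 ∨ ‖(φ p).2‖ = 1) :
    ¬ IsCompactOnBergman (hmaps.restrict φ bidisc bidisc) := by
  have hscale : ∀ (K : ℝ≥0) (n : ℕ), 1 / (4 * ((K : ℝ) + 1) ^ 4) ≤
      (1 / (((K : ℝ) + 1) ^ 2 * testScale n)) ^ 2 * (testScale n ^ 2 / 4) := fun K n => by
    have h3 := testScale_pos n
    have h4 : 0 < (K : ℝ) + 1 := by positivity
    refine le_of_eq ?_
    field_simp
  have ha : ∀ (K : ℝ≥0) (n : ℕ), 0 ≤ 1 / (((K : ℝ) + 1) ^ 2 * testScale n) := fun K n => by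
    have h3 := testScale_pos n
    positivity
  rcases hφp with hη | hη
  · choose S hS hSm hSv hSg using fun n => exists_set_near_value hφ.fst h₁
      (fun z hz => (mem_closure_bidisc_iff.1 (hcl hz)).1) hp hη (testScale_pos n)
      (testScale_le_one n)
    refine not_isCompactOnBergman_of_le_on hmaps
      (f := fun n => diskTest (φ p).1 (testScale n)) (g := fun _ _ => 1)
      (fun n => differentiableOn_diskTest hη (testScale_pos n) (testScale_le_one n))
      (fun n => differentiableOn_const _)
      (fun n => lintegral_diskTest_le hη (testScale_pos n) (testScale_le_half n))
      (fun n => lintegral_enorm_one_le) (fun z hz => ?_) hSm hS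
      (c := 1 / (4 * ((K₁ : ℝ) + 1) ^ 4)) (by positivity) (ha K₁) (fun n z hz => ?_) hSv (hscale K₁)
    · simpa using tendsto_diskTest hη (mem_bidisc_iff.1 hz).1
    · rw [mul_one]
      exact le_norm_diskTest hη (testScale_pos n) (testScale_le_one n)
        (mem_bidisc_iff.1 (hmaps (hS n hz))).1 (hSg n z hz)
  · choose S hS hSm hSv hSg using fun n => exists_set_near_value hφ.snd h₂
      (fun z hz => (mem_closure_bidisc_iff.1 (hcl hz)).2) hp hη (testScale_pos n)
      (testScale_le_one n)
    refine not_isCompactOnBergman_of_le_on hmaps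
      (f := fun _ _ => 1) (g := fun n => diskTest (φ p).2 (testScale n))
      (fun n => differentiableOn_const _)
      (fun n => differentiableOn_diskTest hη (testScale_pos n) (testScale_le_one n))
      (fun n => lintegral_enorm_one_le)
      (fun n => lintegral_diskTest_le hη (testScale_pos n) (testScale_le_half n))
      (fun z hz => ?_) hSm hS
      (c := 1 / (4 * ((K₂ : ℝ) + 1) ^ 4)) (by positivity) (ha K₂) (fun n z hz => ?_) hSv (hscale K₂)
    · simpa using tendsto_diskTest hη (mem_bidisc_iff.1 hz).2
    · rw [one_mul]
      exact le_norm_diskTest hη (testScale_pos n) (testScale_le_one n)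
        (mem_bidisc_iff.1 (hmaps (hS n hz))).2 (hSg n z hz)

/-- If `φ` takes a value on the distinguished boundary, then the composition operator is not
compact. -/
theorem not_isCompactOnBergman_of_mem_torus2 (hmaps : MapsTo φ bidisc bidisc) {K₁ K₂ : ℝ≥0}
    (h₁ : LipschitzOnWith K₁ (fun z => (φ z).1) (closure bidisc))
    (h₂ : LipschitzOnWith K₂ (fun z => (φ z).2) (closure bidisc)) {p : ℂ × ℂ}
    (hp : p ∈ closure bidisc) (hφp : φ p ∈ torus2) :
    ¬ IsCompactOnBergman (hmaps.restrict φ bidisc bidisc) := by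
  obtain ⟨hp1, hp2⟩ := mem_closure_bidisc_iff.1 hp
  have hη₁ : ‖(φ p).1‖ = 1 := mem_sphere_zero_iff_norm.1 hφp.1
  have hη₂ : ‖(φ p).2‖ = 1 := mem_sphere_zero_iff_norm.1 hφp.2
  choose q₁ hq₁ hv₁ using fun n =>
    exists_ball_subset_inter hp1 (testScale_pos n) (testScale_le_one n)
  choose q₂ hq₂ hv₂ using fun n =>
    exists_ball_subset_inter hp2 (testScale_pos n) (testScale_le_one n)
  have hSb : ∀ n, ball (q₁ n) (testScale n / 2) ×ˢ ball (q₂ n) (testScale n / 2) ⊆ bidisc :=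
    fun n z hz => ⟨(hq₁ n hz.1).1, (hq₂ n hz.2).1⟩
  have hdist : ∀ n, ∀ z ∈ ball (q₁ n) (testScale n / 2) ×ˢ ball (q₂ n) (testScale n / 2),
      dist z p ≤ testScale n := fun n z hz =>
    max_le (hq₁ n hz.1).2 (hq₂ n hz.2).2
  refine not_isCompactOnBergman_of_le_on hmaps
    (f := fun n => diskTest (φ p).1 (testScale n)) (g := fun n => diskTest (φ p).2 (testScale n))
    (fun n => differentiableOn_diskTest hη₁ (testScale_pos n) (testScale_le_one n))
    (fun n => differentiableOn_diskTest hη₂ (testScale_pos n) (testScale_le_one n))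
    (fun n => lintegral_diskTest_le hη₁ (testScale_pos n) (testScale_le_half n))
    (fun n => lintegral_diskTest_le hη₂ (testScale_pos n) (testScale_le_half n))
    (fun z hz => ?_) (fun n => measurableSet_ball.prod measurableSet_ball) hSb
    (a := fun n => 1 / (((K₁ : ℝ) + 1) ^ 2 * testScale n) * (1 / (((K₂ : ℝ) + 1) ^ 2 * testScale n)))
    (v := fun n => testScale n ^ 2 / 4 * (testScale n ^ 2 / 4))
    (c := 1 / (16 * ((K₁ : ℝ) + 1) ^ 4 * ((K₂ : ℝ) + 1) ^ 4)) (by positivity) (fun n => ?_)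
    (fun n z hz => ?_) (fun n => ?_) (fun n => ?_)
  · simpa using (tendsto_diskTest hη₁ (mem_bidisc_iff.1 hz).1).mul
      (tendsto_diskTest hη₂ (mem_bidisc_iff.1 hz).2)
  · have := testScale_pos n
    positivity
  · obtain ⟨hz1, hz2⟩ := mem_bidisc_iff.1 (hmaps (hSb n hz))
    have hzc := subset_closure (hSb n hz)
    have hδ := testScale_pos n
    rw [norm_mul]
    refine mul_le_mul
      (le_norm_diskTest hη₁ hδ (testScale_le_one n) hz1 ?_)
      (le_norm_diskTest hη₂ hδ (testScale_le_one n) hz2 ?_) (by positivity) (norm_nonneg _)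
    · rw [← dist_eq_norm]
      exact (h₁.dist_le_mul z hzc p hp).trans (by gcongr; exact hdist n z hz)
    · rw [← dist_eq_norm]
      exact (h₂.dist_le_mul z hzc p hp).trans (by gcongr; exact hdist n z hz)
  · rw [Measure.volume_eq_prod, Measure.prod_prod, ENNReal.ofReal_mul (by positivity)]
    exact mul_le_mul' (hv₁ n) (hv₂ n)
  · have h3 := testScale_pos n
    refine le_of_eq ?_
    field_simp
    ring

theorem IsCompact.exists_le_one_sub {X : Type*} [TopologicalSpace X] {s : Set X} (hs : IsCompact s)
    {f : X → ℝ} (hf : ContinuousOn f s) (h : ∀ x ∈ s, f x < 1) :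
    ∃ c > 0, ∀ x ∈ s, f x ≤ 1 - c := by
  rcases s.eq_empty_or_nonempty with rfl | hne
  · exact ⟨1, one_pos, fun x hx => hx.elim⟩
  obtain ⟨x, hx, hmax⟩ := hs.exists_isMaxOn hne hf
  exact ⟨1 - f x, by linarith [h x hx], fun y hy => by linarith [isMaxOn_iff.1 hmax y hy]⟩

/-- If the boundary of the bidisc is reached only on the distinguished boundary, and `φ` avoids the
distinguished boundary, then the composition operator is compact. -/
theorem isCompactOnBergman_of_disjoint (hmaps : MapsTo φ bidisc bidisc)
    (hφ : DifferentiableOn ℂ φ bidisc) (hcont : ContinuousOn φ (closure bidisc))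
    (hcl : MapsTo φ (closure bidisc) (closure bidisc))
    (h₁ : ∀ p ∈ closure bidisc, φ p ∉ torus2)
    (h₂ : ∀ p ∈ closure bidisc \ torus2, φ p ∈ bidisc) :
    IsCompactOnBergman (hmaps.restrict φ bidisc bidisc) := by
  have hcc : IsCompact (closure bidisc) := by
    rw [closure_bidisc]
    exact (isCompact_closedBall _ _).prod (isCompact_closedBall _ _)
  have haxis : ∀ i : ℂ → ℂ × ℂ, Continuous i →
      MapsTo i (closedBall 0 1) (closure bidisc \ torus2) →
      ∃ c > 0, ∀ z ∈ closedBall (0 : ℂ) 1, ‖φ (i z)‖ ≤ 1 - c := by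
    intro i hi him
    refine (isCompact_closedBall (0 : ℂ) 1).exists_le_one_sub
      (hcont.comp hi.continuousOn fun z hz => (him hz).1).norm fun z hz => ?_
    have := mem_bidisc_iff.1 (h₂ _ (him hz))
    exact max_lt this.1 this.2
  obtain ⟨c₁, hc₁, h3⟩ := haxis (fun z => (z, 0)) (by fun_prop) fun z hz =>
    ⟨mem_closure_bidisc_iff.2 ⟨mem_closedBall_zero_iff.1 hz, by simp⟩, fun h => by
      simpa using mem_sphere_zero_iff_norm.1 h.2⟩
  obtain ⟨c₂, hc₂, h4⟩ := haxis (fun z => (0, z)) (by fun_prop) fun z hz =>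
    ⟨mem_closure_bidisc_iff.2 ⟨by simp, mem_closedBall_zero_iff.1 hz⟩, fun h => by
      simpa using mem_sphere_zero_iff_norm.1 h.1⟩
  obtain ⟨c₃, hc₃, h5⟩ := hcc.exists_le_one_sub
    (f := fun z => min ‖(φ z).1‖ ‖(φ z).2‖) (hcont.fst.norm.inf hcont.snd.norm) fun z hz => by
      by_contra hmin
      obtain ⟨h6, h7⟩ := le_min_iff.1 (not_lt.1 hmin)
      obtain ⟨h8, h9⟩ := mem_closure_bidisc_iff.1 (hcl hz)
      exact h₁ z hz ⟨mem_sphere_zero_iff_norm.2 (le_antisymm h8 h6),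
        mem_sphere_zero_iff_norm.2 (le_antisymm h9 h7)⟩
  set c := min 1 (min c₁ (min c₂ c₃))
  have e1 : c ≤ c₁ := (min_le_right _ _).trans (min_le_left _ _)
  have e2 : c ≤ c₂ := (min_le_right _ _).trans ((min_le_right _ _).trans (min_le_left _ _))
  have e3 : c ≤ c₃ := (min_le_right _ _).trans ((min_le_right _ _).trans (min_le_right _ _))
  obtain ⟨A, hA⟩ := exists_lintegral_comp_le hmaps hφ (c := c) (by positivity) (min_le_left _ _)
    (fun z hz => (h3 z (mem_closedBall_zero_iff.2 hz.le)).trans (by linarith))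
    (fun z hz => (h4 z (mem_closedBall_zero_iff.2 hz.le)).trans (by linarith))
    (fun z hz => by
      rcases min_le_iff.1 (h5 z (subset_closure hz)) with h | h
      · exact Or.inl (by linarith)
      · exact Or.inr (by linarith))
  exact isCompactOnBergman_of_lintegral_comp_le hmaps hφ hA

end BergmanComposition

theorem mainTheorem1 (φ : ℂ × ℂ → ℂ × ℂ)
    (hmaps : MapsTo φ bidisc bidisc)
    (hhol : DifferentiableOn ℂ φ bidisc)
    (hLip1 : ∃ K : NNReal, LipschitzOnWith K (fun z => (φ z).1) (closure bidisc))
    (hLip2 : ∃ K : NNReal, LipschitzOnWith K (fun z => (φ z).2) (closure bidisc)) :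
    IsCompactOnBergman (hmaps.restrict φ bidisc bidisc) ↔
      φ '' closure bidisc ∩ torus2 = ∅ ∧
        φ '' (closure bidisc \ torus2) ∩ frontier bidisc = ∅ := by
  obtain ⟨K₁, h₁⟩ := hLip1
  obtain ⟨K₂, h₂⟩ := hLip2
  have hcont : ContinuousOn φ (closure bidisc) := h₁.continuousOn.prodMk h₂.continuousOn
  have hcl : MapsTo φ (closure bidisc) (closure bidisc) := hmaps.closure_of_continuousOn hcont
  rw [isOpen_bidisc.frontier_eq, eq_empty_iff_forall_notMem, eq_empty_iff_forall_notMem]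
  constructor
  · intro hC
    constructor
    · rintro _ ⟨⟨p, hp, rfl⟩, ht⟩
      exact not_isCompactOnBergman_of_mem_torus2 hmaps h₁ h₂ hp ht hC
    · rintro _ ⟨⟨p, hp, rfl⟩, hfc, hfb⟩
      refine not_isCompactOnBergman_of_norm_eq_one hmaps hhol h₁ h₂ hcl hp ?_ hC
      obtain ⟨hle1, hle2⟩ := mem_closure_bidisc_iff.1 hfc
      by_contra! hne
      exact hfb (mem_bidisc_iff.2 ⟨lt_of_le_of_ne hle1 hne.1, lt_of_le_of_ne hle2 hne.2⟩)
  · rintro ⟨ht, hf⟩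
    refine isCompactOnBergman_of_disjoint hmaps hhol hcont hcl
      (fun p hp h => ht _ ⟨mem_image_of_mem φ hp, h⟩) fun p hp => ?_
    by_contra hb
    exact hf _ ⟨mem_image_of_mem φ hp, hcl hp.1, hb⟩
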